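/- **Theorem (cosimplicial Eilenberg–Zilber).** Let $\mathcal A$ be an abelian category with enough injectives. For a cosimplicial object $Y$ in $\mathcal A$ let $C(Y)$ be its unnormalized cochain complex, $C^n(Y)=Y^n$ with differential $\sum_{i=0}^{n+1}(-1)^i\partial^i$, let $N(Y)\subseteq C(Y)$ be the normalized subcomplex $N^n(Y)=\bigcap_{i=0}^{n-1}\ker(\sigma^i\colon Y^n\to Y^{n-1})$, and let $\pi^n(Y)=H^n(N(Y))$. A cosimplicial bicomplex in $\mathcal A$ is a functor $X=\{X^{p,q}\}\colon\mathbf\Delta\times\mathbf\Delta\to\mathcal A$ ($p$ is the horizontal, $q$ the vertical index). Let $\operatorname{Diag}X$ be the cosimplicial object obtained by composing $X$ with the diagonal $\mathbf\Delta\to\mathbf\Delta\times\mathbf\Delta$, so that $\operatorname{Diag}^pX=X^{p,p}$, and let $\operatorname{Tot}X$ be the total complex of the double cochain complex $C(X)^{p,q}=X^{p,q}$ with differentials $d_h=\sum_{i=0}^{p+1}(-1)^i\partial_h^i$ and $d_v=(-1)^p\sum_{j=0}^{q+1}(-1)^j\partial_v^j$. Let $\pi_v^q(X)$ be the cosimplicial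 object $p\mapsto\pi^q(X^{p,*})$, and write $\pi_h^p\pi_v^q(X)=\pi^p(\pi_v^q(X))$. 1. For every cosimplicial bicomplex $X$ the inclusion $N(\operatorname{Diag}X)\subseteq C(\operatorname{Diag}X)$ induces isomorphisms $\pi^n(\operatorname{Diag}X)\cong H^n(C(\operatorname{Diag}X))$, and for every $n\ge 0$ there is an isomorphism $$\pi^n(\operatorname{Diag}X)\cong H^n(\operatorname{Tot}X)$$ natural in $X$. 2. For every cosimplicial bicomplex $X$ there is a first quadrant cohomological spectral sequence $(E_r,d_r)_{r\ge 1}$, with $d_r\colon E_r^{p,q}\to E_r^{p+r,q-r+1}$, such that $E_1^{p,q}\cong\pi_v^q(X^{p,*})$, with $d_1$ corresponding to $\sum_{i=0}^{p+1}(-1)^i\pi_v^q(\partial_h^i)$, such that $$E_2^{p,q}\cong\pi_h^p\pi_v^q(X),$$ and which converges to $\pi^{p+q}(\operatorname{Diag}X)$: each $\pi^n(\operatorname{Diag}X)$ has a finite decreasing filtration $\pi^n(\operatorname{Diag}X)=F^0\supseteq F^1\supseteq\dots\supseteq F^{n+1}=0$ with $F^p/F^{p+1}\cong E_\infty^{p,q}$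 whenever $p+q=n$, where $E_\infty^{p,q}=E_r^{p,q}$ for $r>\max(p,q+1)$. -/

import Mathlib

open CategoryTheory CategoryTheory.Limits

universe v u

noncomputable section

namespace CosimplicialEZ

attribute [local instance] Abelian.hasPullbacks

/-! ### Normalized cochain complex and cohomotopy of a cosimplicial object -/

section Normalized

open AlgebraicTopology Subobject

variable {A : Type u} [Category.{v} A] [Abelian A]

/-- `N^n(X) = ⋂_{i=0}^{n-1} ker (σ^i : X^n ⟶ X^{n-1})`, a subobject of `X^n`; `N^0(X) = X^0`. -/
def normX (X : CosimplicialObject A) : ∀ n : ℕ, Subobject (X.obj (.mk n))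
  | 0 => ⊤
  | n + 1 => Finset.univ.inf fun i : Fin (n + 1) => kernelSubobject (X.σ i)

lemma normX_arrow_σ (X : CosimplicialObject A) (n : ℕ) (i : Fin (n + 1)) :
    (normX X (n + 1)).arrow ≫ X.σ i = 0 := by
  have h : (kernelSubobject (X.σ i)).Factors (normX X (n + 1)).arrow :=
    finset_inf_arrow_factors Finset.univ
      (fun i : Fin (n + 1) => kernelSubobject (X.σ i)) i (Finset.mem_univ i)
  rw [← factorThru_arrow _ _ h, Category.assoc, kernelSubobject_arrow_comp, comp_zero]

lemma normX_factors_succ (X : CosimplicialObject A) (n : ℕ) {Z : A} (f : Z ⟶ X.obj (.mk (n + 1)))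
    (hf : ∀ i : Fin (n + 1), f ≫ X.σ i = 0) : (normX X (n + 1)).Factors f :=
  (finset_inf_factors f).mpr fun i _ => kernelSubobject_factors _ _ (hf i)

/-- The alternating sum of the cofaces maps `N^n(X)` into `N^{n+1}(X)`. -/
lemma normX_d_factors (X : CosimplicialObject A) (n : ℕ) :
    (normX X (n + 1)).Factors
      ((normX X n).arrow ≫ AlternatingCofaceMapComplex.objD X n) := by
  refine normX_factors_succ X n _ fun j => ?_
  simp only [AlternatingCofaceMapComplex.objD, Category.assoc, Preadditive.sum_comp,
    Preadditive.comp_sum, Preadditive.zsmul_comp, Preadditive.comp_zsmul]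
  rw [Finset.sum_eq_add j.castSucc j.succ]
  · rw [X.δ_comp_σ_self, X.δ_comp_σ_succ]
    simp [pow_succ]
  · exact j.castSucc_lt_succ.ne
  · intro i _ hi
    cases n with
    | zero =>
      exfalso
      have h1 := hi.1
      have h2 := hi.2
      simp only [ne_eq, Fin.ext_iff, Fin.val_castSucc, Fin.val_succ] at h1 h2
      omega
    | succ n =>
      rcases lt_or_gt_of_ne hi.1 with h | h
      · have hv : (i : ℕ) < j := Fin.lt_def.1 h
        obtain ⟨i, rfl⟩ : ∃ k : Fin (n + 2), i = k.castSucc := ⟨⟨i, by omega⟩, rfl⟩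
        obtain ⟨j, rfl⟩ : ∃ k : Fin (n + 1), j = k.succ :=
          ⟨⟨j - 1, by omega⟩, Fin.ext (by simp only [Fin.val_succ]; omega)⟩
        simp only [Fin.val_castSucc, Fin.val_succ] at hv
        rw [X.δ_comp_σ_of_le (Fin.le_def.2 (by simp only [Fin.val_castSucc]; omega)),
          ← Category.assoc (normX X (n + 1)).arrow, normX_arrow_σ, zero_comp, smul_zero]
      · have hv : (j : ℕ) < i := Fin.lt_def.1 h
        have hv' : (i : ℕ) ≠ j + 1 := fun h' => hi.2 (Fin.ext h')
        obtain ⟨i, rfl⟩ : ∃ k : Fin (n + 2), i = k.succ :=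
          ⟨⟨i - 1, by omega⟩, Fin.ext (by simp only [Fin.val_succ]; omega)⟩
        simp only [Fin.val_succ] at hv hv'
        obtain ⟨j, rfl⟩ : ∃ k : Fin (n + 1), j = k.castSucc := ⟨⟨j, by omega⟩, rfl⟩
        simp only [Fin.val_castSucc] at hv hv'
        rw [X.δ_comp_σ_of_gt (Fin.lt_def.2 (by simp only [Fin.val_castSucc]; omega)),
          ← Category.assoc (normX X (n + 1)).arrow, normX_arrow_σ, zero_comp, smul_zero]
  · simp
  · simp

/-- The differential of `N(X)`: the restriction of the alternating sum of the cofaces. -/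
def normD (X : CosimplicialObject A) (n : ℕ) : (normX X n : A) ⟶ (normX X (n + 1) : A) :=
  factorThru _ _ (normX_d_factors X n)

lemma normD_arrow (X : CosimplicialObject A) (n : ℕ) :
    normD X n ≫ (normX X (n + 1)).arrow =
      (normX X n).arrow ≫ AlternatingCofaceMapComplex.objD X n :=
  factorThru_arrow _ _ _

lemma normD_normD (X : CosimplicialObject A) (n : ℕ) : normD X n ≫ normD X (n + 1) = 0 := by
  rw [← cancel_mono (normX X (n + 1 + 1)).arrow, Category.assoc, normD_arrow,
    ← Category.assoc, normD_arrow, Category.assoc, AlternatingCofaceMapComplex.d_squared,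
    comp_zero, zero_comp]

lemma normX_map_factors {X Y : CosimplicialObject A} (f : X ⟶ Y) (n : ℕ) :
    (normX Y n).Factors ((normX X n).arrow ≫ f.app (.mk n)) := by
  cases n with
  | zero => exact top_factors _
  | succ n =>
    refine normX_factors_succ Y n _ fun i => ?_
    rw [Category.assoc, ← CosimplicialObject.σ_naturality, ← Category.assoc, normX_arrow_σ,
      zero_comp]

/-- The map `N^n(X) ⟶ N^n(Y)` obtained by restricting `f^n : X^n ⟶ Y^n`. -/
def normMap {X Y : CosimplicialObject A} (f : X ⟶ Y) (n : ℕ) :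
    (normX X n : A) ⟶ (normX Y n : A) :=
  factorThru _ _ (normX_map_factors f n)

@[simp]
lemma normMap_arrow {X Y : CosimplicialObject A} (f : X ⟶ Y) (n : ℕ) :
    normMap f n ≫ (normX Y n).arrow = (normX X n).arrow ≫ f.app (.mk n) :=
  factorThru_arrow _ _ _

lemma objD_naturality {X Y : CosimplicialObject A} (f : X ⟶ Y) (n : ℕ) :
    f.app (.mk n) ≫ AlternatingCofaceMapComplex.objD Y n =
      AlternatingCofaceMapComplex.objD X n ≫ f.app (.mk (n + 1)) := by
  simp only [AlternatingCofaceMapComplex.objD, Preadditive.sum_comp, Preadditive.comp_sum,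
    Preadditive.zsmul_comp, Preadditive.comp_zsmul, CosimplicialObject.δ_naturality]

lemma normMap_normD {X Y : CosimplicialObject A} (f : X ⟶ Y) (n : ℕ) :
    normMap f n ≫ normD Y n = normD X n ≫ normMap f (n + 1) := by
  rw [← cancel_mono (normX Y (n + 1)).arrow,
    Category.assoc, Category.assoc, normD_arrow, normMap_arrow, ← Category.assoc,
    normMap_arrow, ← Category.assoc, normD_arrow, Category.assoc, Category.assoc,
    objD_naturality]

variable (A)

/-- The normalized cochain complex functor `X ↦ N(X)`. -/
def normalizedCochainComplex : CosimplicialObject A ⥤ CochainComplex A ℕ where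
  obj X := CochainComplex.of (fun n => (normX X n : A)) (normD X) (normD_normD X)
  map {X Y} f := CochainComplex.ofHom (normMap f) fun n =>
    (congrArg (normMap f n ≫ ·) (CochainComplex.of_d _ (normD Y) n)).trans
      ((normMap_normD f n).trans
        (congrArg (· ≫ normMap f (n + 1)) (CochainComplex.of_d _ (normD X) n).symm))
  map_id X := by
    ext n
    exact (normMap_arrow (𝟙 X) n).trans ((Category.comp_id _).trans (Category.id_comp _).symm)
  map_comp {X Y Z} f g := by
    ext n
    refine (normMap_arrow (f ≫ g) n).trans ?_
    change _ = (normMap f n ≫ normMap g n) ≫ (normX Z n).arrow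
    rw [Category.assoc, normMap_arrow, ← Category.assoc, normMap_arrow, Category.assoc]
    rfl

/-- The inclusion `N(X) ⟶ C(X)` of the normalized cochain complex into the unnormalized one. -/
def normalizedInclusion :
    normalizedCochainComplex A ⟶ alternatingCofaceMapComplex A where
  app X := CochainComplex.ofHom (fun n => (normX X n).arrow) fun n => by
    dsimp only [normalizedCochainComplex, alternatingCofaceMapComplex,
      AlternatingCofaceMapComplex.obj]
    rw [CochainComplex.of_d, CochainComplex.of_d, normD_arrow]
  naturality X Y f := by
    ext n
    exact normMap_arrow f n

/-- Cohomotopy `π^n(X) = H^n(N(X))`. -/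
def cohomotopy (n : ℕ) : CosimplicialObject A ⥤ A :=
  normalizedCochainComplex A ⋙ HomologicalComplex.homologyFunctor A (ComplexShape.up ℕ) n

end Normalized

/-! ### Cosimplicial bicomplexes -/

section Bicomplex

open AlgebraicTopology

variable (A : Type u) [Category.{v} A]

/-- Cosimplicial bicomplexes `X = {X^{p,q}}` in `A`: functors `Δ × Δ ⥤ A`. The first (horizontal)
index is `p`, the second (vertical) index is `q`. -/
abbrev CosimplicialBicomplex := SimplexCategory × SimplexCategory ⥤ A

/-- The diagonal `Diag X`, i.e. precomposition with `Δ ⥤ Δ × Δ`; so `Diag^p X = X^{p,p}`. -/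
def Diag : CosimplicialBicomplex A ⥤ CosimplicialObject A :=
  (Functor.whiskeringLeft _ _ A).obj (Functor.diag SimplexCategory)

/-- The cosimplicial object `p ↦ X^{p,*}` of cosimplicial objects. -/
def columns : CosimplicialBicomplex A ⥤ CosimplicialObject (CosimplicialObject A) :=
  Functor.curry

variable [Abelian A]

/-- The cosimplicial object `π_v^q(X) : p ↦ π^q(X^{p,*})`. -/
def verticalCohomotopy (q : ℕ) : CosimplicialBicomplex A ⥤ CosimplicialObject A :=
  columns A ⋙ (CosimplicialObject.whiskering _ _).obj (cohomotopy A q)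

/-- The unnormalized double complex `C(X)`: its `p`-th column is the alternating coface map
complex of `X^{p,*}` and its horizontal differential is the alternating sum of the horizontal
cofaces. (The two differentials commute; the sign `(-1)^p` on the vertical differential is
inserted in the total complex.) -/
def doubleComplex : CosimplicialBicomplex A ⥤
    HomologicalComplex₂ A (ComplexShape.up ℕ) (ComplexShape.up ℕ) :=
  columns A ⋙ (CosimplicialObject.whiskering _ _).obj (alternatingCofaceMapComplex A) ⋙
    alternatingCofaceMapComplex (CochainComplex A ℕ)

/-- The signs of total complexes of double cochain complexes indexed by `ℕ × ℕ`: the horizontal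
differential has sign `1`, the vertical one has sign `(-1)^p`. -/
instance tensorSignsUpNat : (ComplexShape.up ℕ).TensorSigns where
  ε' := MonoidHom.mk' (fun (i : Multiplicative ℕ) => (-1 : ℤˣ) ^ (i.toAdd))
    (fun a b => pow_add (-1 : ℤˣ) a.toAdd b.toAdd)
  rel_add p q r hpq := by
    simp only [ComplexShape.up_Rel] at hpq ⊢
    omega
  add_rel p q r hpq := by
    simp only [ComplexShape.up_Rel] at hpq ⊢
    omega
  ε'_succ p q hpq := by
    obtain rfl : p + 1 = q := hpq
    exact (pow_succ (-1 : ℤˣ) p).trans (mul_neg_one _)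

instance hasTotalNat (K : HomologicalComplex₂ A (ComplexShape.up ℕ) (ComplexShape.up ℕ)) :
    K.HasTotal (ComplexShape.up ℕ) := fun n => by
  have : Finite ((ComplexShape.π (ComplexShape.up ℕ) (ComplexShape.up ℕ)
      (ComplexShape.up ℕ)) ⁻¹' {n}) :=
    Set.Finite.to_subtype (((Set.finite_Iic n).prod (Set.finite_Iic n)).subset (by
      rintro ⟨p, q⟩ (h : p + q = n)
      exact ⟨by simp only [Set.mem_Iic]; omega, by simp only [Set.mem_Iic]; omega⟩))
  exact hasColimitsOfShape_of_equivalence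
    (Discrete.equivalence (Finite.equivFin _).symm) |>.has_colimit _

/-- `Tot(X)`, the total complex of the double complex `C(X)`. -/
def Tot : CosimplicialBicomplex A ⥤ CochainComplex A ℕ :=
  doubleComplex A ⋙ HomologicalComplex₂.totalFunctor A _ _ (ComplexShape.up ℕ)

end Bicomplex

/-! ### Convergence of first quadrant cohomological spectral sequences -/

section Convergence

variable {A : Type u} [Category.{v} A] [Abelian A]

/-- `E_r^{p,q} ⇒ H^{p+q}`: every `H^n` has a finite decreasing filtration
`H^n = F^0 ⊇ F^1 ⊇ ⋯ ⊇ F^{n+1} = 0` with `F^p / F^{p+1} ≅ E_∞^{p,q}` for `p + q = n`. In the first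
quadrant all differentials from and to `E_r^{p,q}` vanish as soon as `r > p` and `r > q + 1`,
so `E_∞^{p,q}` is `E_r^{p,q}` for any such `r`. -/
def ConvergesTo {r₀ : ℤ} (E : CohomologicalSpectralSequenceNat A r₀) (H : ℕ → A) : Prop :=
  ∀ n : ℕ, ∃ (F : ℕ → Subobject (H n)) (hF : Antitone F), F 0 = ⊤ ∧ F (n + 1) = ⊥ ∧
    ∀ p q : ℕ, p + q = n → ∀ (r : ℤ) (hr : r₀ ≤ r), (p : ℤ) < r → (q : ℤ) + 1 < r →
      Nonempty (cokernel (Subobject.ofLE (F (p + 1)) (F p) (hF p.le_succ)) ≅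
        (E.page r hr).X (p, q))

end Convergence

end CosimplicialEZ

end

/-!
The isomorphism `H^n(Tot X) ≅ H^n(C(Diag X))` is obtained without an explicit Alexander-Whitney or
shuffle map. Both sides are cohomological functors of the cosimplicial bicomplex `X`: the
décalage `P X = X^{* + 1, * + 1}` contains `X` as an objectwise retract, and `Tot` and `C ∘ Diag`
turn `0 ⟶ X ⟶ P X ⟶ Q X ⟶ 0` into short exact sequences of complexes because this sequence splits
in each bidegree. Both functors kill `P X` in positive degrees: `C` of a décalage is contracted
in positive degrees by the codegeneracy `σ^0` (`isZero_homology_shift`). Hence `H^{n+1}(X)` is the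
cokernel of `H^n(P X) ⟶ H^n(Q X)` on both sides, and the comparison follows from the case `n = 0`
by induction (`nonempty_homologyFunctor_iso`). In degree zero both sides are computed by cocycles
in `X^{0,0}`, and `comp_objD_Diag_eq_zero_iff` shows that the cocycle conditions agree.

The spectral sequence is that of the double complex `C(X)` filtered by its columns. The
total complexes of the columns with index in an interval `[j, i)` of `ℕ ∪ {∞}` form short exact
sequences for consecutive intervals, so that their cohomology is a spectral object
(`columnSpectralObject`) and yields a spectral sequence. A single column has the vertical
cohomology as its cohomology, the connecting morphism between consecutive columns is induced by
the horizontal differential (`columnHomologyIso_hom_columnConnecting`), and the abutment is the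
cohomology of the total complex (`convergesTo_columnSpectralSequence`). Its convergence also gives
the vanishing of `H^{n+1}(Tot (P X))` used above: `E_2` of `P X` vanishes away from `(0, 0)`.

Unnormalized complexes compute cohomotopy because the inclusion of the normalized subcomplex is a
homotopy equivalence, whose inverse is given by the Dold-Kan projection of the corresponding
simplicial object in the opposite category (`normalizedInclusionHomotopyEquiv`).
-/

noncomputable section

namespace CosimplicialEZ

/-! ### Truncation of cochain complexes to an interval of degrees -/

section Truncation

variable {B : Type u} [Category.{v} B] [Preadditive B] [HasZeroObject B]

/-- For `i ≤ j` in `ℕ∞ᵒᵈ`, i.e. for natural numbers or `∞` with `j ≤ i`, the condition that `p`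
belongs to the interval `[j, i)`. -/
def InInterval (i j : ℕ∞ᵒᵈ) (p : ℕ) : Prop :=
  OrderDual.ofDual j ≤ p ∧ (p : ℕ∞) < OrderDual.ofDual i

lemma inInterval_toDual (a b : ℕ∞) (p : ℕ) :
    InInterval (OrderDual.toDual b) (OrderDual.toDual a) p ↔ a ≤ p ∧ (p : ℕ∞) < b := Iff.rfl

namespace InInterval

lemma mono {i j i' j' : ℕ∞ᵒᵈ} {p : ℕ} (h : InInterval i j p) (hj : j ≤ j')
    (h' : (p : ℕ∞) < OrderDual.ofDual i') : InInterval i' j' p :=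
  ⟨(OrderDual.ofDual_le_ofDual.2 hj).trans h.1, h'⟩

lemma convex {i j : ℕ∞ᵒᵈ} {p q r : ℕ} (hp : InInterval i j p) (hr : InInterval i j r)
    (h : p ≤ q) (h' : q ≤ r) : InInterval i j q :=
  ⟨hp.1.trans (by exact_mod_cast h), lt_of_le_of_lt (by exact_mod_cast h') hr.2⟩

end InInterval

variable (D : CochainComplex B ℕ) (i j : ℕ∞ᵒᵈ) (p : ℕ)

namespace truncAux

open scoped Classical ZeroObject in
/-- The degree `p` part of the truncation of `D` to the interval `[j, i)`. -/
def X : B := if InInterval i j p then D.X p else 0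

variable {i j p} in
lemma X_eq (h : InInterval i j p) : X D i j p = D.X p := if_pos h

open scoped Classical in
/-- The inclusion of the degree `p` part of a truncation. -/
def ι : X D i j p ⟶ D.X p :=
  if h : InInterval i j p then eqToHom (X_eq D h) else 0

open scoped Classical in
/-- The projection to the degree `p` part of a truncation. -/
def π : D.X p ⟶ X D i j p :=
  if h : InInterval i j p then eqToHom (X_eq D h).symm else 0

lemma isZero_X (h : ¬ InInterval i j p) : IsZero (X D i j p) := by
  rw [X, if_neg h]
  exact isZero_zero B

lemma ι_eq_zero (h : ¬ InInterval i j p) : ι D i j p = 0 := dif_neg h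

lemma π_eq_zero (h : ¬ InInterval i j p) : π D i j p = 0 := dif_neg h

lemma ι_π : ι D i j p ≫ π D i j p = 𝟙 _ := by
  by_cases h : InInterval i j p
  · rw [ι, π, dif_pos h, dif_pos h, eqToHom_trans, eqToHom_refl]
  · exact (isZero_X D i j p h).eq_of_src _ _

lemma π_ι (h : InInterval i j p) : π D i j p ≫ ι D i j p = 𝟙 _ := by
  rw [ι, π, dif_pos h, dif_pos h, eqToHom_trans, eqToHom_refl]

end truncAux

/-- The truncation of a cochain complex `D` to the degrees in the interval `[j, i)`. -/
def trunc : CochainComplex B ℕ where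
  X p := truncAux.X D i j p
  d p p' := truncAux.ι D i j p ≫ D.d p p' ≫ truncAux.π D i j p'
  shape p p' h := by rw [D.shape _ _ h, zero_comp, comp_zero]
  d_comp_d' p p' p'' h h' := by
    by_cases hp : InInterval i j p
    · by_cases hp'' : InInterval i j p''
      · obtain rfl : p + 1 = p' := h
        obtain rfl : p + 1 + 1 = p'' := h'
        have hp' : InInterval i j (p + 1) := hp.convex hp'' (by lia) (by lia)
        simp [reassoc_of% (truncAux.π_ι D i j (p + 1) hp')]
      · simp [truncAux.π_eq_zero _ _ _ _ hp'']
    · simp [truncAux.ι_eq_zero _ _ _ _ hp]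

/-- The inclusion of the degree `p` part of a truncation, as a retract of `D.X p`. -/
def truncι : (trunc D i j).X p ⟶ D.X p := truncAux.ι D i j p

/-- The projection to the degree `p` part of a truncation, as a retract of `D.X p`. -/
def truncπ : D.X p ⟶ (trunc D i j).X p := truncAux.π D i j p

lemma trunc_d (p p' : ℕ) : (trunc D i j).d p p' = truncι D i j p ≫ D.d p p' ≫ truncπ D i j p' :=
  rfl

variable {D i j p}

lemma truncι_eq_zero (h : ¬ InInterval i j p) : truncι D i j p = 0 := truncAux.ι_eq_zero _ _ _ _ h

lemma truncπ_eq_zero (h : ¬ InInterval i j p) : truncπ D i j p = 0 := truncAux.π_eq_zero _ _ _ _ h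

lemma isZero_trunc_X (h : ¬ InInterval i j p) : IsZero ((trunc D i j).X p) :=
  truncAux.isZero_X _ _ _ _ h

@[simp]
lemma truncι_truncπ : truncι D i j p ≫ truncπ D i j p = 𝟙 _ := truncAux.ι_π _ _ _ _

lemma truncπ_truncι (h : InInterval i j p) : truncπ D i j p ≫ truncι D i j p = 𝟙 _ :=
  truncAux.π_ι _ _ _ _ h

lemma truncπ_truncι_assoc (h : InInterval i j p) {Z : B} (f : D.X p ⟶ Z) :
    truncπ D i j p ≫ truncι D i j p ≫ f = f := by
  rw [← Category.assoc, truncπ_truncι h, Category.id_comp]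

variable (D)

/-- The maps between the truncations of `D`, given by the identity in the degrees
that belong to both intervals. -/
def truncMap (i j i' j' : ℕ∞ᵒᵈ) (hi : i ≤ i') (hj : j ≤ j') : trunc D i j ⟶ trunc D i' j' where
  f p := truncι D i j p ≫ truncπ D i' j' p
  comm' p p' h := by
    obtain rfl : p + 1 = p' := h
    simp only [trunc_d, Category.assoc]
    by_cases h₁ : InInterval i j p
    · by_cases h₂ : InInterval i' j' (p + 1)
      · have h₁' : InInterval i' j' p :=
          h₁.mono hj (lt_of_le_of_lt (by exact_mod_cast p.le_succ) h₂.2)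
        have h₂' : InInterval i j (p + 1) :=
          ⟨h₁.1.trans (by exact_mod_cast p.le_succ),
            h₂.2.trans_le (OrderDual.ofDual_le_ofDual.2 hi)⟩
        rw [truncπ_truncι_assoc h₁', truncπ_truncι_assoc h₂']
      · simp [truncπ_eq_zero h₂]
    · simp [truncι_eq_zero h₁]

lemma truncMap_f (i j i' j' : ℕ∞ᵒᵈ) (hi : i ≤ i') (hj : j ≤ j') (p : ℕ) :
    (truncMap D i j i' j' hi hj).f p = truncι D i j p ≫ truncπ D i' j' p := rfl

lemma truncMap_id (i j : ℕ∞ᵒᵈ) : truncMap D i j i j le_rfl le_rfl = 𝟙 _ := by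
  ext p
  simp [truncMap_f]

lemma truncMap_comp {i j i' j' i'' j'' : ℕ∞ᵒᵈ} (hi : i ≤ i') (hj : j ≤ j') (hi' : i' ≤ i'')
    (hj' : j' ≤ j'') : truncMap D i j i' j' hi hj ≫ truncMap D i' j' i'' j'' hi' hj' =
      truncMap D i j i'' j'' (hi.trans hi') (hj.trans hj') := by
  ext p
  simp only [HomologicalComplex.comp_f, truncMap_f, Category.assoc]
  by_cases h : InInterval i j p
  · by_cases h'' : InInterval i'' j'' p
    · rw [truncπ_truncι_assoc
        (h.mono hj (h''.2.trans_le (OrderDual.ofDual_le_ofDual.2 hi')))]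
    · simp [truncπ_eq_zero h'']
  · simp [truncι_eq_zero h]

/-- The truncations of `D`, as a functor on the category of arrows of `ℕ∞ᵒᵈ`. -/
def truncFunctor : ComposableArrows ℕ∞ᵒᵈ 1 ⥤ CochainComplex B ℕ where
  obj f := trunc D (f.obj 0) (f.obj 1)
  map φ := truncMap D _ _ _ _ (leOfHom (φ.app 0)) (leOfHom (φ.app 1))
  map_id _ := truncMap_id D _ _
  map_comp _ _ := (truncMap_comp D _ _ _ _).symm

/-- The truncation to the interval `[0, ∞)` changes nothing. -/
def truncTopIso : trunc D (OrderDual.toDual ⊤) (OrderDual.toDual 0) ≅ D :=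
  have H (p : ℕ) : InInterval (OrderDual.toDual ⊤) (OrderDual.toDual 0) p :=
    (inInterval_toDual _ _ _).2 ⟨bot_le, ENat.natCast_lt_top p⟩
  HomologicalComplex.Hom.isoOfComponents
    (fun p => ⟨truncι D _ _ p, truncπ D _ _ p, truncι_truncπ, truncπ_truncι (H p)⟩)
    (fun p p' _ => by
      dsimp only
      rw [trunc_d, Category.assoc, Category.assoc, truncπ_truncι (H p'), Category.comp_id])

section Splitting

variable (i j k : ℕ∞ᵒᵈ) (hij : i ≤ j) (hjk : j ≤ k)

/-- The short complex `D[j, i) ⟶ D[k, i) ⟶ D[k, j)` of truncations. It is split in every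
degree: see `truncRetraction` and `truncSection`. -/
abbrev truncShortComplex : ShortComplex (CochainComplex B ℕ) :=
  ShortComplex.mk (truncMap D i j i k le_rfl hjk) (truncMap D i k j k hij le_rfl) (by
    rw [truncMap_comp]
    ext p
    rw [truncMap_f]
    by_cases h : InInterval i j p
    · rw [truncπ_eq_zero (fun h' => absurd (h.1.trans_lt h'.2) (lt_irrefl _)), comp_zero,
        HomologicalComplex.zero_f]
    · rw [truncι_eq_zero h, zero_comp, HomologicalComplex.zero_f])

/-- The retraction `D[k, i) ⟶ D[j, i)` in degree `p`. -/
def truncRetraction (p : ℕ) : (trunc D i k).X p ⟶ (trunc D i j).X p :=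
  truncι D i k p ≫ truncπ D i j p

/-- The section `D[k, j) ⟶ D[k, i)` in degree `p`. -/
def truncSection (p : ℕ) : (trunc D j k).X p ⟶ (trunc D i k).X p :=
  truncι D j k p ≫ truncπ D i k p

include hjk in
lemma truncMap_truncRetraction (p : ℕ) :
    (truncMap D i j i k le_rfl hjk).f p ≫ truncRetraction D i j k p = 𝟙 _ := by
  by_cases h : InInterval i j p
  · simp [truncMap_f, truncRetraction, truncπ_truncι_assoc (h.mono hjk h.2)]
  · exact (isZero_trunc_X h).eq_of_src _ _

include hij in
lemma truncSection_truncMap (p : ℕ) :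
    truncSection D i j k p ≫ (truncMap D i k j k hij le_rfl).f p = 𝟙 _ := by
  by_cases h : InInterval j k p
  · simp [truncMap_f, truncSection, truncπ_truncι_assoc (h.mono le_rfl
      (h.2.trans_le (OrderDual.ofDual_le_ofDual.2 hij)) : InInterval i k p)]
  · exact (isZero_trunc_X h).eq_of_src _ _

include hij hjk in
lemma truncRetraction_add_truncSection (p : ℕ) :
    truncRetraction D i j k p ≫ (truncMap D i j i k le_rfl hjk).f p +
      (truncMap D i k j k hij le_rfl).f p ≫ truncSection D i j k p = 𝟙 _ := by
  simp only [truncMap_f, truncRetraction, truncSection, Category.assoc]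
  by_cases h : InInterval i k p
  · by_cases h' : (p : ℕ∞) < OrderDual.ofDual j
    · rw [truncπ_truncι_assoc (⟨h.1, h'⟩ : InInterval j k p),
        truncπ_eq_zero (i := i) (j := j) (fun h'' => absurd (h''.1.trans_lt h') (lt_irrefl _))]
      simp
    · rw [truncπ_truncι_assoc (⟨le_of_not_gt h', h.2⟩ : InInterval i j p),
        truncπ_eq_zero (i := j) (fun h'' => h' h''.2)]
      simp
  · exact (isZero_trunc_X h).eq_of_src _ _

end Splitting

end Truncation

/-! ### The spectral object attached to a functorial family of short exact sequences -/

section SpectralObject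

open ComposableArrows HomologicalComplex

variable {A : Type u} [Category.{v} A] [Abelian A] {ι : Type*} [Category ι]
  (K : ComposableArrows ι 1 ⥤ CochainComplex A ℤ)
  (hK₀ : ∀ D : ComposableArrows ι 2, K.map ((mapFunctorArrows ι 0 1 0 2 2).app D) ≫
    K.map ((mapFunctorArrows ι 0 2 1 2 2).app D) = 0)

/-- The short complex `K(f) ⟶ K(f ≫ g) ⟶ K(g)`. -/
def arrowsShortComplex : ComposableArrows ι 2 ⥤ ShortComplex (CochainComplex A ℤ) where
  obj D := ShortComplex.mk _ _ (hK₀ D)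
  map {D D'} φ :=
    { τ₁ := K.map ((functorArrows ι 0 1 2).map φ)
      τ₂ := K.map ((functorArrows ι 0 2 2).map φ)
      τ₃ := K.map ((functorArrows ι 1 2 2).map φ)
      comm₁₂ := (K.map_comp _ _).symm.trans
        ((congrArg K.map ((mapFunctorArrows ι 0 1 0 2 2).naturality φ)).trans (K.map_comp _ _))
      comm₂₃ := (K.map_comp _ _).symm.trans
        ((congrArg K.map ((mapFunctorArrows ι 0 2 1 2 2).naturality φ)).trans (K.map_comp _ _)) }
  map_id D := by
    ext1
    · exact (congrArg K.map ((functorArrows ι 0 1 2).map_id D)).trans (K.map_id _)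
    · exact (congrArg K.map ((functorArrows ι 0 2 2).map_id D)).trans (K.map_id _)
    · exact (congrArg K.map ((functorArrows ι 1 2 2).map_id D)).trans (K.map_id _)
  map_comp φ ψ := by
    ext1
    · exact (congrArg K.map ((functorArrows ι 0 1 2).map_comp φ ψ)).trans (K.map_comp _ _)
    · exact (congrArg K.map ((functorArrows ι 0 2 2).map_comp φ ψ)).trans (K.map_comp _ _)
    · exact (congrArg K.map ((functorArrows ι 1 2 2).map_comp φ ψ)).trans (K.map_comp _ _)

/-- The spectral object `H^n(f) = H^n(K(f))` for a functor `K` from the arrows of `ι` to cochain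
complexes, when all the sequences `0 ⟶ K(f) ⟶ K(f ≫ g) ⟶ K(g) ⟶ 0` are short exact. -/
def spectralObjectOfShortExact
    (hK : ∀ D : ComposableArrows ι 2, ((arrowsShortComplex K hK₀).obj D).ShortExact) :
    Abelian.SpectralObject A ι where
  H n := K ⋙ homologyFunctor A _ n
  δ' n₀ n₁ h :=
    { app D := (hK D).δ n₀ n₁ h
      naturality D D' φ := (HomologySequence.δ_naturality ((arrowsShortComplex K hK₀).map φ)
        (hK D) (hK D') n₀ n₁ h).symm }
  exact₁' n₀ n₁ h D := ((hK D).homology_exact₁ n₀ n₁ h).exact_toComposableArrows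
  exact₂' n D := ((hK D).homology_exact₂ n).exact_toComposableArrows
  exact₃' n₀ n₁ h D := ((hK D).homology_exact₃ n₀ n₁ h).exact_toComposableArrows

end SpectralObject

/-! ### Short exact sequences of bicomplexes and of total complexes -/

section Total

open HomologicalComplex

variable {A : Type u} [Category.{v} A] [Abelian A]

/-- The total complex of a double cochain complex, extended by zero to negative degrees. -/
def totalInt : HomologicalComplex₂ A (ComplexShape.up ℕ) (ComplexShape.up ℕ) ⥤
    CochainComplex A ℤ :=
  HomologicalComplex₂.totalFunctor A _ _ (ComplexShape.up ℕ) ⋙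
    ComplexShape.embeddingUpNat.extendFunctor A

instance : (HomologicalComplex₂.totalFunctor A (ComplexShape.up ℕ) (ComplexShape.up ℕ)
    (ComplexShape.up ℕ)).PreservesZeroMorphisms where
  map_zero K L := by
    ext n
    refine HomologicalComplex₂.total.hom_ext _ fun p q h => ?_
    refine (HomologicalComplex₂.ιTotal_map K L (0 : K ⟶ L) _ p q n h).trans ?_
    rw [zero_f, zero_f, zero_comp]
    exact comp_zero.symm

/-- The total complexes of a short complex of bicomplexes that is split in each bidegree
form a short exact sequence. -/
lemma shortExact_total
    (S : ShortComplex (HomologicalComplex₂ A (ComplexShape.up ℕ) (ComplexShape.up ℕ)))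
    (r : ∀ p q, (S.X₂.X p).X q ⟶ (S.X₁.X p).X q) (s : ∀ p q, (S.X₃.X p).X q ⟶ (S.X₂.X p).X q)
    (f_r : ∀ p q, (S.f.f p).f q ≫ r p q = 𝟙 _) (s_g : ∀ p q, s p q ≫ (S.g.f p).f q = 𝟙 _)
    (h : ∀ p q, r p q ≫ (S.f.f p).f q + (S.g.f p).f q ≫ s p q = 𝟙 _) :
    (S.map (HomologicalComplex₂.totalFunctor A _ _ (ComplexShape.up ℕ))).ShortExact := by
  refine shortExact_of_degreewise_shortExact _ fun n => ?_
  let R : (S.X₂.total (ComplexShape.up ℕ)).X n ⟶ (S.X₁.total (ComplexShape.up ℕ)).X n :=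
    S.X₂.totalDesc fun p q hpq => r p q ≫ S.X₁.ιTotal (ComplexShape.up ℕ) p q n hpq
  let T : (S.X₃.total (ComplexShape.up ℕ)).X n ⟶ (S.X₂.total (ComplexShape.up ℕ)).X n :=
    S.X₃.totalDesc fun p q hpq => s p q ≫ S.X₂.ιTotal (ComplexShape.up ℕ) p q n hpq
  have h₁ : (HomologicalComplex₂.total.map S.f (ComplexShape.up ℕ)).f n ≫ R = 𝟙 _ := by
    ext p q hpq
    rw [HomologicalComplex₂.ιTotal_map_assoc, HomologicalComplex₂.ι_totalDesc, reassoc_of% f_r,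
      Category.comp_id]
  have h₂ : T ≫ (HomologicalComplex₂.total.map S.g (ComplexShape.up ℕ)).f n = 𝟙 _ := by
    ext p q hpq
    rw [HomologicalComplex₂.ι_totalDesc_assoc, Category.assoc, HomologicalComplex₂.ιTotal_map,
      reassoc_of% s_g, Category.comp_id]
  have h₃ : R ≫ (HomologicalComplex₂.total.map S.f (ComplexShape.up ℕ)).f n +
      (HomologicalComplex₂.total.map S.g (ComplexShape.up ℕ)).f n ≫ T = 𝟙 _ := by
    ext p q hpq
    rw [Preadditive.comp_add, HomologicalComplex₂.ι_totalDesc_assoc, Category.assoc,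
      HomologicalComplex₂.ιTotal_map, HomologicalComplex₂.ιTotal_map_assoc,
      HomologicalComplex₂.ι_totalDesc, ← Category.assoc, ← Category.assoc,
      ← Preadditive.add_comp, h, Category.id_comp, Category.comp_id]
  exact ShortComplex.Splitting.shortExact { r := R, s := T, f_r := h₁, s_g := h₂, id := h₃ }

/-- Extension by zero of cochain complexes is exact. -/
lemma shortExact_extend {S : ShortComplex (CochainComplex A ℕ)} (hS : S.ShortExact) :
    (S.map (ComplexShape.embeddingUpNat.extendFunctor A)).ShortExact := by
  refine shortExact_of_degreewise_shortExact _ fun n => ?_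
  by_cases hn : ∃ k, ComplexShape.embeddingUpNat.f k = n
  · obtain ⟨k, hk⟩ := hn
    have comm {K L : CochainComplex A ℕ} (φ : K ⟶ L) : (K.extendXIso _ hk).inv ≫
        (extendMap φ ComplexShape.embeddingUpNat).f n = φ.f k ≫ (L.extendXIso _ hk).inv := by
      rw [extendMap_f _ _ hk, Iso.inv_hom_id_assoc]
    exact ShortComplex.shortExact_of_iso
      (ShortComplex.isoMk (S.X₁.extendXIso _ hk).symm (S.X₂.extendXIso _ hk).symm
        (S.X₃.extendXIso _ hk).symm (comm S.f) (comm S.g))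
      (hS.map_of_exact (eval A _ k))
  · have H (K : CochainComplex A ℕ) : IsZero ((K.extend ComplexShape.embeddingUpNat).X n) :=
      K.isZero_extend_X _ _ (fun k hk => hn ⟨k, hk⟩)
    exact { exact := ShortComplex.exact_of_isZero_X₂ _ (H S.X₂)
            mono_f := ⟨fun _ _ _ => (H S.X₁).eq_of_tgt _ _⟩
            epi_g := ⟨fun _ _ _ => (H S.X₃).eq_of_src _ _⟩ }

end Total

/-! ### The spectral object of a first quadrant double complex -/

section ColumnSpectralObject

open HomologicalComplex ComposableArrows

variable {A : Type u} [Category.{v} A] [Abelian A]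
  (D : HomologicalComplex₂ A (ComplexShape.up ℕ) (ComplexShape.up ℕ))

/-- The total complexes of the truncations of `D` to intervals of columns. -/
def truncTotal : ComposableArrows ℕ∞ᵒᵈ 1 ⥤ CochainComplex A ℤ := truncFunctor D ⋙ totalInt

lemma shortExact_truncTotal (i j k : ℕ∞ᵒᵈ) (hij : i ≤ j) (hjk : j ≤ k) :
    (((truncShortComplex D i j k hij hjk).map
      (HomologicalComplex₂.totalFunctor A _ _ (ComplexShape.up ℕ))).map
        (ComplexShape.embeddingUpNat.extendFunctor A)).ShortExact := by
  refine shortExact_extend (shortExact_total _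
    (fun p q => (truncRetraction D i j k p).f q) (fun p q => (truncSection D i j k p).f q)
    (fun p q => ?_) (fun p q => ?_) (fun p q => ?_))
  · exact (comp_f _ _ _).symm.trans (congr_hom (truncMap_truncRetraction D i j k hjk p) q)
  · exact (comp_f _ _ _).symm.trans (congr_hom (truncSection_truncMap D i j k hij p) q)
  · exact congr_hom (truncRetraction_add_truncSection D i j k hij hjk p) q

/-- The spectral object of the double complex `D` filtered by its columns: `H^n(i ⟶ j)` is the
cohomology in degree `n` of the total complex of the columns of `D` with index in `[j, i)`. -/
def columnSpectralObject : Abelian.SpectralObject A ℕ∞ᵒᵈ :=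
  spectralObjectOfShortExact (truncTotal D)
    (fun E => (((truncShortComplex D (E.obj 0) (E.obj 1) (E.obj 2) (leOfHom (E.map' 0 1))
      (leOfHom (E.map' 1 2))).map
        (HomologicalComplex₂.totalFunctor A _ _ (ComplexShape.up ℕ))).map
          (ComplexShape.embeddingUpNat.extendFunctor A)).zero)
    (fun E => shortExact_truncTotal D (E.obj 0) (E.obj 1) (E.obj 2)
      (leOfHom (E.map' 0 1)) (leOfHom (E.map' 1 2)))

lemma isZero_columnSpectralObject (i j : ℕ∞ᵒᵈ) (hij : i ⟶ j) (n : ℤ)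
    (h : ∀ p : ℕ, OrderDual.ofDual j ≤ p → n < p) :
    IsZero (((columnSpectralObject D).H n).obj (mk₁ hij)) := by
  refine ShortComplex.isZero_homology_of_isZero_X₂ _ ?_
  change IsZero (((HomologicalComplex₂.total (trunc D i j) (ComplexShape.up ℕ)).extend
    ComplexShape.embeddingUpNat).X n)
  by_cases hn : ∃ k, ComplexShape.embeddingUpNat.f k = n
  · obtain ⟨k, rfl⟩ := hn
    refine IsZero.of_iso ?_ (extendXIso _ _ rfl)
    rw [IsZero.iff_id_eq_zero]
    ext p q hpq
    obtain rfl : p + q = k := hpq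
    have hp : ¬ InInterval i j p := fun hp => by
      have := h p hp.1
      have h' : ComplexShape.embeddingUpNat.f (p + q) = ((p + q : ℕ) : ℤ) := rfl
      lia
    exact ((eval A _ q).map_isZero (isZero_trunc_X hp)).eq_of_src _ _
  · exact isZero_extend_X _ _ _ (fun k hk => hn ⟨k, hk⟩)

/-- The recipe for the spectral sequence of a filtration indexed by `ℕ`, starting with
the page `E_1`: on the page `r`, the object in bidegree `(p, q)` is obtained from the filtration
steps `p + r ≥ p + 1 ≥ p ≥ p + 1 - r` (truncated at zero). -/
def coreE₁ : Abelian.SpectralObject.SpectralSequenceDataCore ℕ∞ᵒᵈ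
    (fun r ↦ ComplexShape.spectralSequenceNat ⟨r, 1 - r⟩) 1 where
  deg pq := pq.1 + pq.2
  i₀ r pq _ := OrderDual.toDual ((pq.1 + r).toNat : ℕ∞)
  i₁ pq := OrderDual.toDual ((pq.1 + 1 : ℕ) : ℕ∞)
  i₂ pq := OrderDual.toDual (pq.1 : ℕ∞)
  i₃ r pq _ := OrderDual.toDual ((pq.1 + 1 - r).toNat : ℕ∞)
  le₀₁ r pq hr := OrderDual.toDual_le_toDual.2 (Nat.cast_le.2 (by lia))
  le₁₂ pq := OrderDual.toDual_le_toDual.2 (Nat.cast_le.2 (by lia))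
  le₂₃ r pq hr := OrderDual.toDual_le_toDual.2 (Nat.cast_le.2 (by lia))
  hc r pq pq' h hr := by
    have := h.1
    have := h.2
    dsimp at *
    lia
  hc₀₂ r pq pq' h hr := by
    have := h.1
    dsimp at this
    rw [this, Int.toNat_natCast]
  hc₁₃ r pq pq' h hr := by
    have := h.1
    dsimp at this
    congr 2
    lia
  antitone_i₀ r r' pq hr h := OrderDual.toDual_le_toDual.2 (Nat.cast_le.2 (by lia))
  monotone_i₃ r r' pq hr h := OrderDual.toDual_le_toDual.2 (Nat.cast_le.2 (by lia))
  i₀_prev r r' pq pq' h hrr' hr := by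
    have := h.1
    dsimp at this
    congr 2
    lia
  i₃_next r r' pq pq' h hrr' hr := by
    have := h.1
    dsimp at this
    congr 2
    lia

instance : coreE₁.HasFirstPageComputation where
  hi₀₁ pq := rfl
  hi₂₃ pq := by
    dsimp [coreE₁]
    congr 2
    lia

instance : (columnSpectralObject D).HasSpectralSequence coreE₁ where
  isZero_H_obj_mk₁_i₀_le r r' pq hpq n hn hrr' hr := by
    refine isZero_columnSpectralObject _ _ _ _ _ fun p hp => ?_
    have hp' : (pq.1 + r).toNat ≤ p := Nat.cast_le.1 hp
    have hn' : n = pq.1 + pq.2 + 1 := hn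
    by_contra!
    exact hpq ((pq.1 + r).toNat, (pq.2 + 1 - r).toNat) ⟨by dsimp; lia, by dsimp; lia⟩
  isZero_H_obj_mk₁_i₃_le r r' pq hpq n hn hrr' hr := by
    have : coreE₁.i₃ r pq = coreE₁.i₃ r' pq := by
      refine congrArg (fun k : ℕ => OrderDual.toDual (k : ℕ∞)) ?_
      by_contra!
      exact hpq ((pq.1 - r).toNat, (pq.2 + r - 1).toNat) ⟨by dsimp; lia, by dsimp; lia⟩
    have := isIso_homOfLE this
    exact (columnSpectralObject D).isZero_H_map_mk₁_of_isIso _ _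

end ColumnSpectralObject

/-! ### The total complex of a range of columns -/

section FirstPage

open HomologicalComplex ComposableArrows

variable {A : Type u} [Category.{v} A] [Abelian A]
  (D : HomologicalComplex₂ A (ComplexShape.up ℕ) (ComplexShape.up ℕ))

lemma ιTotal_d (p q n n' : ℕ) (h : p + q = n) (h' : n + 1 = n') :
    D.ιTotal (ComplexShape.up ℕ) p q n h ≫ (D.total (ComplexShape.up ℕ)).d n n' =
      (D.d p (p + 1)).f q ≫ D.ιTotal (ComplexShape.up ℕ) (p + 1) q n'
          (show p + 1 + q = n' by lia) +
        (-1 : ℤ) ^ p • (D.X p).d q (q + 1) ≫ D.ιTotal (ComplexShape.up ℕ) p (q + 1) n'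
          (show p + (q + 1) = n' by lia) := by
  rw [HomologicalComplex₂.total_d, Preadditive.comp_add, HomologicalComplex₂.ι_D₁,
    HomologicalComplex₂.ι_D₂, HomologicalComplex₂.d₁_eq (i₁' := p + 1) _ _ rfl _ _
      (show p + 1 + q = n' by lia), HomologicalComplex₂.d₂_eq (i₂' := q + 1) _ _ _ rfl _
      (show p + (q + 1) = n' by lia)]
  have h₁ : ComplexShape.ε₁ (ComplexShape.up ℕ) (ComplexShape.up ℕ) (ComplexShape.up ℕ) (p, q)
    = 1 := rfl
  have h₂ : ComplexShape.ε₂ (ComplexShape.up ℕ) (ComplexShape.up ℕ) (ComplexShape.up ℕ) (p, q)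
    = (-1) ^ p := rfl
  rw [h₁, h₂, one_smul, Units.smul_def]
  simp

/-- The projection of the total complex onto the summand `D^{p, q}`. -/
def πTotal (p q n : ℕ) (h : p + q = n) :
    (D.total (ComplexShape.up ℕ)).X n ⟶ (D.X p).X q :=
  D.totalDesc fun p' q' h' =>
    if hp : p' = p then
      (D.XXIsoOfEq _ _ _ hp (by have h₃ : p' + q' = n := h'; lia)).hom else 0

lemma ιTotal_πTotal (p q n : ℕ) (h : p + q = n) :
    D.ιTotal (ComplexShape.up ℕ) p q n h ≫ πTotal D p q n h = 𝟙 _ := by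
  rw [πTotal, HomologicalComplex₂.ι_totalDesc, dif_pos rfl]
  rfl

lemma ιTotal_πTotal_of_ne (p q p' q' n : ℕ) (h : p + q = n) (h' : p' + q' = n) (hp : p' ≠ p) :
    D.ιTotal (ComplexShape.up ℕ) p' q' n h' ≫ πTotal D p q n h = 0 := by
  rw [πTotal, HomologicalComplex₂.ι_totalDesc, dif_neg hp]

/-- If `D^{p, q}` is the only nonzero summand in degree `n`, then it is the total complex in this
degree. -/
lemma πTotal_ιTotal (p q n : ℕ) (h : p + q = n)
    (hD : ∀ p' q' : ℕ, p' + q' = n → p' ≠ p → IsZero ((D.X p').X q')) :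
    πTotal D p q n h ≫ D.ιTotal (ComplexShape.up ℕ) p q n h = 𝟙 _ := by
  ext p' q' h'
  rw [Category.comp_id, πTotal, HomologicalComplex₂.ι_totalDesc_assoc]
  by_cases hp : p' = p
  · rw [dif_pos hp, HomologicalComplex₂.XXIsoOfEq_hom_ιTotal]
  · exact (hD p' q' h' hp).eq_of_src _ _

/-- The object in degree `n` of `totalInt.obj D`, when `n` is the natural number `m`. -/
def totalIntXIso (m : ℕ) (n : ℤ) (h : (m : ℤ) = n) :
    (totalInt.obj D).X n ≅ (D.total (ComplexShape.up ℕ)).X m :=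
  extendXIso _ ComplexShape.embeddingUpNat h

/-- The inclusion of the summand `D^{p, q}` in the total complex, extended to integer degrees. -/
def ιTotalInt (p q : ℕ) (n : ℤ) (h : (p : ℤ) + q = n) : (D.X p).X q ⟶ (totalInt.obj D).X n :=
  D.ιTotal (ComplexShape.up ℕ) p q (p + q) rfl ≫
    (totalIntXIso D (p + q) n (by rw [Nat.cast_add, h])).inv

lemma ιTotalInt_eq (p q m : ℕ) (hm : p + q = m) (n : ℤ) (h : (m : ℤ) = n) :
    ιTotalInt D p q n (by rw [← Nat.cast_add, hm, h]) =
      D.ιTotal (ComplexShape.up ℕ) p q m hm ≫ (totalIntXIso D m n h).inv := by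
  subst hm
  rfl

lemma totalIntXIso_inv_d (m : ℕ) (n n' : ℤ) (h : (m : ℤ) = n) (h' : ((m + 1 : ℕ) : ℤ) = n') :
    (totalIntXIso D m n h).inv ≫ (totalInt.obj D).d n n' =
      (D.total (ComplexShape.up ℕ)).d m (m + 1) ≫ (totalIntXIso D (m + 1) n' h').inv :=
  (Iso.inv_comp_eq _).2 (extend_d_eq (D.total (ComplexShape.up ℕ))
    ComplexShape.embeddingUpNat (i := m) (j := m + 1) h h')

lemma totalIntXIso_inv_map {D D' : HomologicalComplex₂ A (ComplexShape.up ℕ) (ComplexShape.up ℕ)}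
    (f : D ⟶ D') (m : ℕ) (n : ℤ) (h : (m : ℤ) = n) :
    (totalIntXIso D m n h).inv ≫ (totalInt.map f).f n =
      (HomologicalComplex₂.total.map f (ComplexShape.up ℕ)).f m ≫ (totalIntXIso D' m n h).inv :=
  (Iso.inv_comp_eq _).2 (extendMap_f (HomologicalComplex₂.total.map f (ComplexShape.up ℕ))
    ComplexShape.embeddingUpNat (i := m) h)

lemma ιTotalInt_d (p q : ℕ) (n n' : ℤ) (h : (p : ℤ) + q = n) (h' : n + 1 = n') :
    ιTotalInt D p q n h ≫ (totalInt.obj D).d n n' =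
      (D.d p (p + 1)).f q ≫ ιTotalInt D (p + 1) q n' (by lia) +
        (-1 : ℤ) ^ p • (D.X p).d q (q + 1) ≫ ιTotalInt D p (q + 1) n' (by lia) := by
  rw [ιTotalInt_eq D (p + 1) q (p + q + 1) (by lia) n' (by lia),
    ιTotalInt_eq D p (q + 1) (p + q + 1) (by lia) n' (by lia), ιTotalInt, Category.assoc,
    totalIntXIso_inv_d D (p + q) n n' (by lia) (by lia),
    reassoc_of% (ιTotal_d D p q (p + q) (p + q + 1) rfl rfl), Preadditive.add_comp, Category.assoc,
    Preadditive.zsmul_comp, Category.assoc]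

lemma ιTotalInt_map {D D' : HomologicalComplex₂ A (ComplexShape.up ℕ) (ComplexShape.up ℕ)}
    (f : D ⟶ D') (p q : ℕ) (n : ℤ) (h : (p : ℤ) + q = n) :
    ιTotalInt D p q n h ≫ (totalInt.map f).f n = (f.f p).f q ≫ ιTotalInt D' p q n h := by
  rw [ιTotalInt, Category.assoc, totalIntXIso_inv_map,
    HomologicalComplex₂.ιTotal_map_assoc, ιTotalInt]

lemma isZero_totalInt_X (n : ℤ) (h : ∀ p q : ℕ, (p : ℤ) + q = n → IsZero ((D.X p).X q)) :
    IsZero ((totalInt.obj D).X n) := by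
  by_cases hn : ∃ k : ℕ, (k : ℤ) = n
  · obtain ⟨k, hk⟩ := hn
    refine IsZero.of_iso ?_ (totalIntXIso D k n hk)
    rw [IsZero.iff_id_eq_zero]
    ext p q hpq
    obtain rfl : p + q = k := hpq
    exact (h p q (by lia)).eq_of_src _ _
  · exact isZero_extend_X (D.total (ComplexShape.up ℕ)) ComplexShape.embeddingUpNat _
      (fun k hk => hn ⟨k, hk⟩)

variable (i j : ℕ∞ᵒᵈ)

/-- The map from the component `D^{p, q}` to the total complex of the columns of `D` with
index in `[j, i)`: it is the inclusion of a summand if `p ∈ [j, i)`, and zero otherwise. -/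
def columnι (p q : ℕ) (n : ℤ) (h : (p : ℤ) + q = n) :
    (D.X p).X q ⟶ (totalInt.obj (trunc D i j)).X n :=
  (truncπ D i j p).f q ≫ ιTotalInt (trunc D i j) p q n h

variable {i j}

lemma columnι_eq_zero (p q : ℕ) (n : ℤ) (h : (p : ℤ) + q = n) (hp : ¬ InInterval i j p) :
    columnι D i j p q n h = 0 := by
  rw [columnι, truncπ_eq_zero hp, zero_f, zero_comp]

lemma columnι_d (p q : ℕ) (n n' : ℤ) (h : (p : ℤ) + q = n) (h' : n + 1 = n')
    (hp : InInterval i j p) :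
    columnι D i j p q n h ≫ (totalInt.obj (trunc D i j)).d n n' =
      (D.d p (p + 1)).f q ≫ columnι D i j (p + 1) q n' (by lia) +
        (-1 : ℤ) ^ p • (D.X p).d q (q + 1) ≫ columnι D i j p (q + 1) n' (by lia) := by
  have e₂ : truncπ D i j p ≫ (trunc D i j).d p (p + 1) =
      D.d p (p + 1) ≫ truncπ D i j (p + 1) := by
    rw [trunc_d, truncπ_truncι_assoc hp]
  have e₃ := congr_hom e₂ q
  rw [comp_f, comp_f] at e₃
  rw [columnι, columnι, columnι, Category.assoc, ιTotalInt_d _ p q n n' h h',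
    ← reassoc_of% e₃, ← Hom.comm_assoc, Preadditive.comp_add, Preadditive.comp_zsmul]

lemma columnι_map {i' j' : ℕ∞ᵒᵈ} (hi : i ≤ i') (hj : j ≤ j') (p q : ℕ) (n : ℤ)
    (h : (p : ℤ) + q = n) (hp : InInterval i j p) :
    columnι D i j p q n h ≫ (totalInt.map (truncMap D i j i' j' hi hj)).f n =
      columnι D i' j' p q n h := by
  have e₂ : truncπ D i j p ≫ (truncMap D i j i' j' hi hj).f p = truncπ D i' j' p := by
    rw [truncMap_f, truncπ_truncι_assoc hp]
  rw [columnι, columnι, Category.assoc, ιTotalInt_map, ← e₂, comp_f, Category.assoc]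

lemma isZero_totalInt_trunc_X (n : ℤ) (h : ∀ p : ℕ, OrderDual.ofDual j ≤ p → n < p) :
    IsZero ((totalInt.obj (trunc D i j)).X n) :=
  isZero_totalInt_X _ n fun p q hpq => (eval A _ q).map_isZero (isZero_trunc_X fun hp => by
    have := h p hp.1
    lia)

section SingleColumn

variable (p : ℕ)

/-- The total complex of the double complex that consists of the column of `D` of index `p`. -/
abbrev columnTotal : CochainComplex A ℤ :=
  totalInt.obj (trunc D (OrderDual.toDual ((p + 1 : ℕ) : ℕ∞)) (OrderDual.toDual (p : ℕ∞)))

lemma inInterval_single (p' : ℕ) : InInterval (OrderDual.toDual ((p + 1 : ℕ) : ℕ∞))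
    (OrderDual.toDual (p : ℕ∞)) p' ↔ p' = p := by
  rw [inInterval_toDual, Nat.cast_le, Nat.cast_lt]
  lia

lemma isIso_columnι_single (q : ℕ) (n : ℤ) (h : (p : ℤ) + q = n) :
    IsIso (columnι D (OrderDual.toDual ((p + 1 : ℕ) : ℕ∞)) (OrderDual.toDual (p : ℕ∞))
      p q n h) := by
  have hp := (inInterval_single p p).2 rfl
  have h₁ : IsIso ((truncπ D (OrderDual.toDual ((p + 1 : ℕ) : ℕ∞))
      (OrderDual.toDual (p : ℕ∞)) p).f q) :=
    ⟨(truncι D _ _ p).f q,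
      (comp_f _ _ _).symm.trans (congr_hom (truncπ_truncι hp) q),
      (comp_f _ _ _).symm.trans (congr_hom truncι_truncπ q)⟩
  have h₂ : IsIso (HomologicalComplex₂.ιTotal (trunc D (OrderDual.toDual ((p + 1 : ℕ) : ℕ∞))
      (OrderDual.toDual (p : ℕ∞))) (ComplexShape.up ℕ) p q (p + q) rfl) := by
    exact ⟨πTotal _ p q (p + q) rfl, ιTotal_πTotal _ _ _ _ _,
      πTotal_ιTotal _ _ _ _ _ fun p' q' _ hp' => (eval A _ q').map_isZero (isZero_trunc_X
        fun h' => hp' ((inInterval_single p p').1 h'))⟩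
  have h₃ : IsIso (ιTotalInt (trunc D (OrderDual.toDual ((p + 1 : ℕ) : ℕ∞))
      (OrderDual.toDual (p : ℕ∞))) p q n h) := by
    unfold ιTotalInt
    infer_instance
  unfold columnι
  infer_instance

lemma isZero_columnTotal_X (n : ℤ) (hn : n < p) : IsZero ((columnTotal D p).X n) :=
  isZero_totalInt_trunc_X D n fun p' hp' => by
    have : p ≤ p' := Nat.cast_le.1 hp'
    lia

end SingleColumn

end FirstPage

/-! ### The cohomology of a single column and the connecting morphisms -/

section FirstPageHomology

open HomologicalComplex ComposableArrows

variable {A : Type u} [Category.{v} A] [Abelian A]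
  (D : HomologicalComplex₂ A (ComplexShape.up ℕ) (ComplexShape.up ℕ)) (p q : ℕ) (n : ℤ)
  (h : (p : ℤ) + q = n)

lemma columnι_single_d (q : ℕ) (n n' : ℤ) (h : (p : ℤ) + q = n) (h' : n + 1 = n') :
    columnι D (OrderDual.toDual ((p + 1 : ℕ) : ℕ∞)) (OrderDual.toDual (p : ℕ∞)) p q n h ≫
        (columnTotal D p).d n n' =
      (-1 : ℤ) ^ p • (D.X p).d q (q + 1) ≫ columnι D (OrderDual.toDual ((p + 1 : ℕ) : ℕ∞))
        (OrderDual.toDual (p : ℕ∞)) p (q + 1) n' (by lia) := by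
  rw [columnι_d D p q n n' h h' ((inInterval_single p p).2 rfl),
    columnι_eq_zero D (p + 1) q n' (by lia) (fun h => by
      have := (inInterval_single p (p + 1)).1 h
      lia), comp_zero, zero_add]

lemma d_columnι_congr (i j : ℕ∞ᵒᵈ) (r : ℕ) {q q' : ℕ} (e : q = q') (n : ℤ)
    (h : (p : ℤ) + q = n) (h' : (p : ℤ) + q' = n) :
    (D.X p).d r q ≫ columnι D i j p q n h = (D.X p).d r q' ≫ columnι D i j p q' n h' := by
  subst e
  rfl

lemma prev_eq_of_succ_eq {q : ℕ} (hq : (ComplexShape.up ℕ).prev q + 1 = q) (h : (p : ℤ) + q = n) :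
    (p : ℤ) + ((ComplexShape.up ℕ).prev q : ℕ) = (ComplexShape.up ℤ).prev n := by
  rw [CochainComplex.prev]
  lia

lemma next_eq (h : (p : ℤ) + q = n) :
    (p : ℤ) + ((ComplexShape.up ℕ).next q : ℕ) = (ComplexShape.up ℤ).next n := by
  rw [CochainComplex.next, CochainComplex.next]
  lia

/-- The component in degree `q - 1` of `columnScHom`. It is zero for `q = 0`, where
`(ComplexShape.up ℕ).prev q` is `q` itself and the total complex vanishes in the preceding
degree. -/
def columnScHomτ₁ : (D.X p).X ((ComplexShape.up ℕ).prev q) ⟶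
    (columnTotal D p).X ((ComplexShape.up ℤ).prev n) :=
  if hq : (ComplexShape.up ℕ).prev q + 1 = q then
    (-1 : ℤ) ^ p • columnι D _ _ p ((ComplexShape.up ℕ).prev q) ((ComplexShape.up ℤ).prev n)
      (prev_eq_of_succ_eq p n hq h) else 0

lemma columnScHomτ₁_d : columnScHomτ₁ D p q n h ≫
    (columnTotal D p).d ((ComplexShape.up ℤ).prev n) n =
      (D.X p).d ((ComplexShape.up ℕ).prev q) q ≫ columnι D _ _ p q n h := by
  by_cases hq : (ComplexShape.up ℕ).prev q + 1 = q
  · rw [columnScHomτ₁, dif_pos hq, Preadditive.zsmul_comp,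
      columnι_single_d D p _ ((ComplexShape.up ℤ).prev n) n
        (prev_eq_of_succ_eq p n hq h) (by rw [CochainComplex.prev]; lia),
      smul_smul, ← mul_pow, neg_one_mul, neg_neg, one_pow, one_smul]
    exact d_columnι_congr D _ _ _ _ hq _ _ _
  · rw [columnScHomτ₁, dif_neg hq, (D.X p).shape _ _ hq, zero_comp, zero_comp]

/-- The part of the column of index `p` of `D` around the degree `q`, compared with the
total complex of this column. The signs account for the sign of the vertical differential in the
total complex. -/
def columnScHom : (D.X p).sc q ⟶ (columnTotal D p).sc n where
  τ₁ := columnScHomτ₁ D p q n h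
  τ₂ := columnι D _ _ p q n h
  τ₃ := (-1 : ℤ) ^ p • columnι D _ _ p ((ComplexShape.up ℕ).next q) ((ComplexShape.up ℤ).next n)
    (next_eq p q n h)
  comm₁₂ := columnScHomτ₁_d D p q n h
  comm₂₃ := by
    have hn : (ComplexShape.up ℕ).next q = q + 1 := CochainComplex.next ℕ q
    have e := columnι_single_d D p q n ((ComplexShape.up ℤ).next n) h
      (CochainComplex.next ℤ n).symm
    refine e.trans (Eq.trans ?_ (Preadditive.comp_zsmul _ _ _).symm)
    congr 1
    exact d_columnι_congr D _ _ _ _ hn.symm _ _ _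

lemma isIso_zsmul_neg_one_pow {X Y : A} (f : X ⟶ Y) [IsIso f] (k : ℕ) :
    IsIso ((-1 : ℤ) ^ k • f) := by
  rcases neg_one_pow_eq_or ℤ k with h | h <;> rw [h]
  · rw [one_smul]
    infer_instance
  · rw [neg_smul, one_smul]
    exact ⟨-inv f, by simp, by simp⟩

lemma quasiIso_columnScHom : ShortComplex.QuasiIso (columnScHom D p q n h) := by
  have h₂ : IsIso (columnScHom D p q n h).τ₂ := isIso_columnι_single D p q n h
  have h₃ : IsIso (columnScHom D p q n h).τ₃ :=
    have := isIso_columnι_single D p _ _ (next_eq p q n h)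
    isIso_zsmul_neg_one_pow (columnι D (OrderDual.toDual ((p + 1 : ℕ) : ℕ∞))
      (OrderDual.toDual (p : ℕ∞)) p _ _ (next_eq p q n h)) p
  -- for `q = 0` the target of `τ₁` is zero, but its source need not be
  have h₁ : Epi (columnScHom D p q n h).τ₁ := by
    by_cases hq : (ComplexShape.up ℕ).prev q + 1 = q
    · have e : (columnScHom D p q n h).τ₁ = (-1 : ℤ) ^ p • columnι D _ _ p
          ((ComplexShape.up ℕ).prev q) ((ComplexShape.up ℤ).prev n)
          (prev_eq_of_succ_eq p n hq h) := dif_pos hq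
      have := isIso_columnι_single D p _ _ (prev_eq_of_succ_eq p n hq h)
      rw [e]
      exact @IsIso.epi_of_iso _ _ _ _ _ (@isIso_zsmul_neg_one_pow _ _ _ _ _ _ this p)
    · have hq' : q = 0 := by
        by_contra hq'
        obtain ⟨q, rfl⟩ := Nat.exists_eq_succ_of_ne_zero hq'
        exact hq (congrArg (· + 1) (CochainComplex.prev_nat_succ q))
      exact ⟨fun _ _ _ => (isZero_columnTotal_X D p _ (by
        rw [CochainComplex.prev]
        lia)).eq_of_src _ _⟩
  exact ShortComplex.quasiIso_of_epi_of_isIso_of_mono _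

/-- The cohomology of a column of `D` identifies to the cohomology of its total complex. -/
def columnHomologyIso : (D.X p).homology q ≅ (columnTotal D p).homology n :=
  @asIso _ _ _ _ (ShortComplex.homologyMap (columnScHom D p q n h))
    ((ShortComplex.quasiIso_iff _).1 (quasiIso_columnScHom D p q n h))

/-- On cocycles, `columnHomologyIso` is the inclusion of the summand `D^{p, q}`. -/
lemma homologyπ_columnHomologyIso_hom :
    (D.X p).homologyπ q ≫ (columnHomologyIso D p q n h).hom =
      (columnTotal D p).liftCycles ((D.X p).iCycles q ≫ columnι D _ _ p q n h) (n + 1)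
        (CochainComplex.next ℤ n) (by
          rw [Category.assoc, columnι_single_d D p q n (n + 1) h rfl, Preadditive.comp_zsmul,
            iCycles_d_assoc, zero_comp, smul_zero]) ≫ (columnTotal D p).homologyπ n := by
  refine (ShortComplex.homologyπ_naturality (columnScHom D p q n h)).trans ?_
  refine congrArg (· ≫ (columnTotal D p).homologyπ n) ?_
  refine (cancel_mono ((columnTotal D p).iCycles n)).1 (Eq.trans ?_ (liftCycles_i _ _ _ _ _).symm)
  exact ShortComplex.cyclesMap_i (columnScHom D p q n h)

lemma iCycles_columnι_single_d :
    ((D.X p).iCycles q ≫ columnι D (OrderDual.toDual ((p + 1 : ℕ) : ℕ∞))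
      (OrderDual.toDual (p : ℕ∞)) p q n h) ≫ (columnTotal D p).d n (n + 1) = 0 := by
  rw [Category.assoc, columnι_single_d D p q n (n + 1) h rfl, Preadditive.comp_zsmul,
    iCycles_d_assoc, zero_comp, smul_zero]

/-- The connecting morphism in cohomology for the short exact sequence of the total complexes
of the columns with index in `[j, i)`, in `[k, i)`, and in `[k, j)`. -/
def columnConnecting (i j k : ℕ∞ᵒᵈ) (hij : i ≤ j) (hjk : j ≤ k) (n n' : ℤ) (h : n + 1 = n') :
    (totalInt.obj (trunc D j k)).homology n ⟶ (totalInt.obj (trunc D i j)).homology n' :=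
  (shortExact_truncTotal D i j k hij hjk).δ n n' h

/-- The usual recipe for the connecting morphism: lift a cocycle, apply the differential, and
lift the result to a cocycle of the subcomplex. -/
lemma liftCycles_columnConnecting {i j k : ℕ∞ᵒᵈ} (hij : i ≤ j) (hjk : j ≤ k) (n n' : ℤ)
    (h : n + 1 = n') {Z : A} (x₃ : Z ⟶ (totalInt.obj (trunc D j k)).X n)
    (hx₃ : x₃ ≫ (totalInt.obj (trunc D j k)).d n n' = 0)
    (x₂ : Z ⟶ (totalInt.obj (trunc D i k)).X n)
    (hx₂ : x₂ ≫ (totalInt.map (truncMap D i k j k hij le_rfl)).f n = x₃)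
    (x₁ : Z ⟶ (totalInt.obj (trunc D i j)).X n')
    (hx₁ : x₁ ≫ (totalInt.map (truncMap D i j i k le_rfl hjk)).f n' =
      x₂ ≫ (totalInt.obj (trunc D i k)).d n n')
    (hx₁' : x₁ ≫ (totalInt.obj (trunc D i j)).d n' (n' + 1) = 0) :
    (totalInt.obj (trunc D j k)).liftCycles x₃ n' ((CochainComplex.next ℤ n).trans h) hx₃ ≫
      (totalInt.obj (trunc D j k)).homologyπ n ≫ columnConnecting D i j k hij hjk n n' h =
    (totalInt.obj (trunc D i j)).liftCycles x₁ (n' + 1) (CochainComplex.next ℤ n') hx₁' ≫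
      (totalInt.obj (trunc D i j)).homologyπ n' :=
  (shortExact_truncTotal D i j k hij hjk).δ_eq n n' h x₃ hx₃ x₂ hx₂ x₁ hx₁ (n' + 1)
    (CochainComplex.next ℤ n')

/-- The connecting morphism between the cohomologies of two consecutive columns of `D` is induced
by the horizontal differential. -/
lemma columnHomologyIso_hom_columnConnecting (n' : ℤ) (hn' : n + 1 = n')
    (hpp : OrderDual.toDual ((p + 1 + 1 : ℕ) : ℕ∞) ≤ OrderDual.toDual ((p + 1 : ℕ) : ℕ∞))
    (hp : OrderDual.toDual ((p + 1 : ℕ) : ℕ∞) ≤ OrderDual.toDual (p : ℕ∞)) :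
    (columnHomologyIso D p q n h).hom ≫ columnConnecting D _ _ _ hpp hp n n' hn' =
    homologyMap (D.d p (p + 1)) q ≫ (columnHomologyIso D (p + 1) q n' (by lia)).hom := by
  subst hn'
  -- the inclusion of `D^{p, q}` in the columns `p` and `p + 1` lifts a vertical cocycle; its
  -- differential is the horizontal one, since the vertical part vanishes
  rw [← cancel_epi ((D.X p).homologyπ q), reassoc_of% (homologyπ_columnHomologyIso_hom D p q n h)]
  have hp₁ := (inInterval_single (p + 1) (p + 1)).2 rfl
  have hp₂ : InInterval (OrderDual.toDual ((p + 1 + 1 : ℕ) : ℕ∞)) (OrderDual.toDual (p : ℕ∞)) p :=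
    ⟨le_rfl, Nat.cast_lt.2 (by lia)⟩
  rw [liftCycles_columnConnecting D hpp hp n (n + 1) rfl _ (iCycles_columnι_single_d D p q n h)
    ((D.X p).iCycles q ≫ columnι D _ _ p q n h)
    (by rw [Category.assoc, columnι_map D hpp le_rfl p q n h hp₂])
    (cyclesMap (D.d p (p + 1)) q ≫ (D.X (p + 1)).iCycles q ≫ columnι D _ _ (p + 1) q (n + 1)
      (by lia))
    (by
      rw [Category.assoc, Category.assoc, Category.assoc,
        columnι_map D le_rfl hp (p + 1) q (n + 1) (by lia) hp₁,
        columnι_d D p q n (n + 1) h rfl hp₂, Preadditive.comp_add, Preadditive.comp_zsmul,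
        iCycles_d_assoc, zero_comp, smul_zero, add_zero, cyclesMap_i_assoc])
    (by rw [Category.assoc, iCycles_columnι_single_d D (p + 1) q (n + 1) (by lia), comp_zero]),
    homologyπ_naturality_assoc, homologyπ_columnHomologyIso_hom, comp_liftCycles_assoc]

end FirstPageHomology

/-! ### The spectral sequence of a first quadrant double complex -/

section ColumnSpectralSequence

open HomologicalComplex ComposableArrows

variable {A : Type u} [Category.{v} A] [Abelian A]
  (D : HomologicalComplex₂ A (ComplexShape.up ℕ) (ComplexShape.up ℕ))

/-- The spectral sequence of the double complex `D` filtered by its columns. -/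
def columnSpectralSequence : CohomologicalSpectralSequenceNat A 1 :=
  (columnSpectralObject D).spectralSequence coreE₁

/-- `E_1^{p, q}` is the cohomology in degree `q` of the column of index `p`. -/
def columnE₁Iso (p q : ℕ) :
    ((columnSpectralSequence D).page 1 le_rfl).X (p, q) ≅ (D.X p).homology q :=
  (columnSpectralObject D).spectralSequenceFirstPageXIso coreE₁ (p, q)
    (OrderDual.toDual ((p + 1 : ℕ) : ℕ∞)) (OrderDual.toDual (p : ℕ∞)) rfl rfl (p + q) rfl ≪≫
      (columnHomologyIso D p q (p + q) rfl).symm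

lemma columnSpectralSequence_rel (p q : ℕ) :
    (ComplexShape.spectralSequenceNat ((1, 1 - 1) : ℤ × ℤ)).Rel (p, q) (p + 1, q) :=
  ⟨by dsimp, by dsimp; lia⟩

/-- The differential of the first page is induced by the horizontal differential. -/
lemma columnE₁Iso_comm (p q : ℕ) :
    ((columnSpectralSequence D).page 1 le_rfl).d (p, q) (p + 1, q) ≫
        (columnE₁Iso D (p + 1) q).hom =
      (columnE₁Iso D p q).hom ≫ homologyMap (D.d p (p + 1)) q := by
  have hpp : OrderDual.toDual ((p + 1 + 1 : ℕ) : ℕ∞) ≤ OrderDual.toDual ((p + 1 : ℕ) : ℕ∞) :=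
    OrderDual.toDual_le_toDual.2 (Nat.cast_le.2 (by lia))
  have hp : OrderDual.toDual ((p + 1 : ℕ) : ℕ∞) ≤ OrderDual.toDual (p : ℕ∞) :=
    OrderDual.toDual_le_toDual.2 (Nat.cast_le.2 (by lia))
  have hn : (p : ℤ) + q + 1 = ((p + 1 : ℕ) : ℤ) + q := by lia
  have e := (columnSpectralObject D).spectralSequence_first_page_d_eq coreE₁ (p, q) (p + 1, q)
    (columnSpectralSequence_rel p q) (OrderDual.toDual ((p + 1 + 1 : ℕ) : ℕ∞))
    (OrderDual.toDual ((p + 1 : ℕ) : ℕ∞)) (OrderDual.toDual (p : ℕ∞)) rfl rfl rfl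
    (p + q) (((p + 1 : ℕ) : ℤ) + q) rfl hn
  have e' := columnHomologyIso_hom_columnConnecting D p q _ rfl _ hn hpp hp
  have e'' : columnConnecting D _ _ _ hpp hp _ _ hn ≫
      (columnHomologyIso D (p + 1) q _ rfl).inv =
      (columnHomologyIso D p q _ rfl).inv ≫ homologyMap (D.d p (p + 1)) q := by
    rw [Iso.eq_inv_comp, reassoc_of% e', Iso.hom_inv_id, Category.comp_id]
  refine (congrArg (· ≫ (columnE₁Iso D (p + 1) q).hom) e).trans ?_
  refine (Category.assoc _ _ _).trans ?_
  refine (congrArg (((columnSpectralObject D).spectralSequenceFirstPageXIso coreE₁ (p, q)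
    (OrderDual.toDual ((p + 1 : ℕ) : ℕ∞)) (OrderDual.toDual (p : ℕ∞)) rfl rfl (p + q) rfl).hom ≫ ·)
      ?_).trans (Category.assoc _ _ _).symm
  refine (Category.assoc _ _ _).trans ?_
  exact (congrArg (columnConnecting D _ _ _ hpp hp _ _ hn ≫ ·)
    (Iso.inv_hom_id_assoc _ _)).trans e''

/-- The complex formed by the cohomology objects in degree `q` of the columns of `D`. -/
abbrev columnHomologyComplex (q : ℕ) : CochainComplex A ℕ :=
  ((homologyFunctor A (ComplexShape.up ℕ) q).mapHomologicalComplex (ComplexShape.up ℕ)).obj D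

lemma columnE₁Iso_d (p p' q : ℕ) :
    ((columnSpectralSequence D).page 1 le_rfl).d (p, q) (p', q) ≫ (columnE₁Iso D p' q).hom =
      (columnE₁Iso D p q).hom ≫ (columnHomologyComplex D q).d p p' := by
  by_cases h : p + 1 = p'
  · subst h
    exact columnE₁Iso_comm D p q
  · have h₁ : ((columnSpectralSequence D).page 1 le_rfl).d (p, q) (p', q) = 0 :=
      shape _ (p, q) (p', q) (fun h' => h (by
        have := h'.1
        dsimp at this
        lia))
    have h₂ : (columnHomologyComplex D q).d p p' = 0 := shape _ p p' h
    rw [h₁, h₂, zero_comp]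
    exact comp_zero.symm

lemma columnSpectralSequence_prev (p q : ℕ) :
    (ComplexShape.spectralSequenceNat ((1, 1 - 1) : ℤ × ℤ)).prev (p, q) =
      ((ComplexShape.up ℕ).prev p, q) := by
  cases p with
  | zero =>
    rw [CochainComplex.prev_nat_zero]
    refine ComplexShape.prev_eq_self _ _ fun h => ?_
    have := h.1
    dsimp at this
    lia
  | succ p =>
    rw [CochainComplex.prev_nat_succ]
    exact ComplexShape.prev_eq' _ (columnSpectralSequence_rel p q)

/-- `E_2^{p, q}` is the cohomology in degree `p` of the complex formed by the vertical cohomology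
objects in degree `q`. -/
def columnE₂Iso (p q : ℕ) :
    ((columnSpectralSequence D).page 2 one_le_two).X (p, q) ≅
      (columnHomologyComplex D q).homology p :=
  ((columnSpectralSequence D).iso 1 2 (p, q) rfl le_rfl).symm ≪≫
    ((columnSpectralSequence D).page 1 le_rfl).homologyIsoSc' ((ComplexShape.up ℕ).prev p, q)
      (p, q) (p + 1, q) (columnSpectralSequence_prev p q)
      (ComplexShape.next_eq' _ (columnSpectralSequence_rel p q)) ≪≫
    ShortComplex.homologyMapIso (ShortComplex.isoMk (columnE₁Iso D _ q) (columnE₁Iso D p q)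
      (columnE₁Iso D (p + 1) q) (columnE₁Iso_d D _ p q).symm (columnE₁Iso_d D p (p + 1) q).symm) ≪≫
    ((columnHomologyComplex D q).homologyIsoSc' _ p (p + 1) rfl (CochainComplex.next ℕ p)).symm

end ColumnSpectralSequence

/-! ### Convergence -/

section Convergence

open HomologicalComplex ComposableArrows

variable {A : Type u} [Category.{v} A] [Abelian A]

/-- The quotient of two nested subobjects `X ⊆ Y` of `Z` identifies to the third object of
a short exact sequence `0 ⟶ X ⟶ Y ⟶ Q ⟶ 0`. -/
def cokernelOfLEIso {S : ShortComplex A} (hS : S.ShortExact) {Z : A} (a : S.X₁ ⟶ Z)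
    (b : S.X₂ ⟶ Z) [Mono a] [Mono b] (hab : S.f ≫ b = a)
    (h : Subobject.mk a ≤ Subobject.mk b) :
    cokernel (Subobject.ofLE _ _ h) ≅ S.X₃ :=
  cokernel.mapIso _ S.f (Subobject.underlyingIso a) (Subobject.underlyingIso b) (by
    rw [← cancel_mono b, Category.assoc, Category.assoc, hab,
      Subobject.underlyingIso_hom_comp_eq_mk, Subobject.underlyingIso_hom_comp_eq_mk,
      Subobject.ofLE_arrow]) ≪≫
  IsColimit.coconePointUniqueUpToIso (colimit.isColimit _) hS.gIsCokernel

variable (D : HomologicalComplex₂ A (ComplexShape.up ℕ) (ComplexShape.up ℕ))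

lemma toDual_top_le (p : ℕ) : OrderDual.toDual (⊤ : ℕ∞) ≤ OrderDual.toDual (p : ℕ∞) :=
  OrderDual.toDual_le_toDual.2 le_top

lemma toDual_le_zero (p : ℕ) : OrderDual.toDual (p : ℕ∞) ≤ OrderDual.toDual ((0 : ℕ) : ℕ∞) :=
  OrderDual.toDual_le_toDual.2 (by simp)

/-- The cohomology of the total complex of `D`, seen as a value of the spectral object. -/
abbrev columnAbutment (n : ℤ) : A :=
  ((columnSpectralObject D).H n).obj (mk₁ (homOfLE (toDual_top_le 0)))

/-- The step of index `p` of the filtration by columns of the cohomology of the total complex. -/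
abbrev columnFiltrationι (p : ℕ) (n : ℤ) :
    (columnSpectralObject D).opcycles (homOfLE (toDual_top_le p)) (homOfLE (toDual_le_zero p)) n ⟶
      columnAbutment D n :=
  (columnSpectralObject D).fromOpcycles (homOfLE (toDual_top_le p)) (homOfLE (toDual_le_zero p))
    (homOfLE (toDual_top_le 0)) rfl n

lemma toDual_succ_le (p : ℕ) : OrderDual.toDual ((p + 1 : ℕ) : ℕ∞) ≤ OrderDual.toDual (p : ℕ∞) :=
  OrderDual.toDual_le_toDual.2 (Nat.cast_le.2 (by lia))

/-- The short exact sequence relating two consecutive steps of the filtration by columns. -/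
abbrev columnFiltrationShortComplex (p : ℕ) (n : ℤ) : ShortComplex A :=
  (columnSpectralObject D).shortComplexOpcyclesThreeδ₂Toδ₁ (homOfLE (toDual_top_le (p + 1)))
    (homOfLE (toDual_succ_le p)) (homOfLE (toDual_le_zero p)) (homOfLE (toDual_top_le p))
    (homOfLE (toDual_le_zero (p + 1))) rfl rfl (n - 1) n (n + 1)

lemma columnFiltrationShortComplex_f (p : ℕ) (n : ℤ) :
    (columnFiltrationShortComplex D p n).f ≫ columnFiltrationι D p n =
      columnFiltrationι D (p + 1) n := by
  refine ((columnSpectralObject D).opcyclesMap_fromOpcycles _ _ _ _ _ rfl _ _ _ (𝟙 _) n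
    rfl rfl).trans ?_
  exact (congrArg (_ ≫ ·) (CategoryTheory.Functor.map_id _ _)).trans (Category.comp_id _)

/-- The graded pieces of the filtration by columns are the objects `E_r^{p, q}` for `r` large
enough. -/
def columnGradedIso (p q : ℕ) (r : ℤ) (hr : 1 ≤ r) (hp : (p : ℤ) < r) (hq : (q : ℤ) + 1 < r) :
    (columnFiltrationShortComplex D p (p + q)).X₃ ≅
      ((columnSpectralSequence D).page r hr).X (p, q) :=
  -- the filtration steps of index at least `p + r > p + q + 1` do not contribute in degrees up to
  -- `p + q + 1`, and the step of index `p + 1 - r` truncated at zero is the whole complex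
  (columnSpectralObject D).isoMapFourδ₁Toδ₀' (OrderDual.toDual ⊤)
    (OrderDual.toDual (((p : ℤ) + r).toNat : ℕ∞)) (OrderDual.toDual ((p + 1 : ℕ) : ℕ∞))
    (OrderDual.toDual (p : ℕ∞)) (OrderDual.toDual ((0 : ℕ) : ℕ∞)) (toDual_top_le _)
    (OrderDual.toDual_le_toDual.2 (Nat.cast_le.2 (by lia))) (toDual_succ_le p) (toDual_le_zero p)
    (p + q - 1) (p + q) (p + q + 1) (isZero_columnSpectralObject D _ _ _ _ (fun p' hp' => by
      have : ((p : ℤ) + r).toNat ≤ p' := Nat.cast_le.1 hp'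
      lia)) ≪≫
  ((columnSpectralObject D).spectralSequencePageXIso coreE₁ r hr (p, q) _ _ _ _ rfl rfl rfl
    (congrArg (fun k : ℕ => OrderDual.toDual (k : ℕ∞))
      (show 0 = ((p : ℤ) + 1 - r).toNat by lia)) (p + q - 1) (p + q) (p + q + 1) rfl (by lia)
          rfl).symm

lemma isZero_columnFiltration (p : ℕ) (n : ℤ) (h : n < p) :
    IsZero ((columnSpectralObject D).opcycles (homOfLE (toDual_top_le p))
      (homOfLE (toDual_le_zero p)) n) := by
  have h' : IsZero (((columnSpectralObject D).H n).obj (mk₁ (homOfLE (toDual_top_le p)))) :=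
    isZero_columnSpectralObject D _ _ _ _ fun p' hp' => by
      have : p ≤ p' := Nat.cast_le.1 hp'
      lia
  exact h'.of_epi ((columnSpectralObject D).pOpcycles _ _ n)

lemma isIso_columnFiltrationι_zero (n : ℤ) : IsIso (columnFiltrationι D 0 n) := by
  have := isIso_homOfLE (rfl : OrderDual.toDual ((0 : ℕ) : ℕ∞) = OrderDual.toDual ((0 : ℕ) : ℕ∞))
  exact (columnSpectralObject D).isIso_fromOpcycles _ _ _ _ _
    ((columnSpectralObject D).isZero_H_map_mk₁_of_isIso _ _)

/-- The cohomology of the total complex identifies to the abutment of the spectral sequence. -/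
def columnAbutmentIso (n : ℕ) :
    columnAbutment D n ≅ (D.total (ComplexShape.up ℕ)).homology n :=
  ((HomologicalComplex₂.totalFunctor A (ComplexShape.up ℕ) (ComplexShape.up ℕ)
      (ComplexShape.up ℕ)).obj (trunc D (OrderDual.toDual ⊤)
        (OrderDual.toDual 0))).extendHomologyIso ComplexShape.embeddingUpNat (j := n) rfl ≪≫
    (HomologicalComplex₂.totalFunctor A (ComplexShape.up ℕ) (ComplexShape.up ℕ)
      (ComplexShape.up ℕ) ⋙ homologyFunctor A (ComplexShape.up ℕ) n).mapIso (truncTopIso D)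

/-- The spectral sequence of `D` converges to the cohomology of the total complex. -/
lemma convergesTo_columnSpectralSequence (H : ℕ → A)
    (e : ∀ n, (D.total (ComplexShape.up ℕ)).homology n ≅ H n) :
    ConvergesTo (columnSpectralSequence D) H := by
  intro n
  have hmono (p : ℕ) : Mono (columnFiltrationι D p n) := by infer_instance
  let a (p : ℕ) := columnFiltrationι D p n ≫ (columnAbutmentIso D n ≪≫ e n).hom
  have ha (p : ℕ) : Mono (a p) := mono_comp _ _
  have hS (p : ℕ) : (columnFiltrationShortComplex D p n).f ≫ a p = a (p + 1) := by
    exact (Category.assoc _ _ _).symm.trans (congrArg (· ≫ (columnAbutmentIso D n ≪≫ e n).hom)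
      (columnFiltrationShortComplex_f D p n))
  have hF : Antitone fun p => Subobject.mk (a p) :=
    antitone_nat_of_succ_le fun p => Subobject.mk_le_mk_of_comm _ (hS p)
  refine ⟨fun p => Subobject.mk (a p), hF, ?_, ?_, fun p q hpq r hr hp hq => ?_⟩
  · have := isIso_columnFiltrationι_zero D n
    have : IsIso (a 0) := IsIso.comp_isIso
    exact Subobject.mk_eq_top_of_isIso _
  · exact Subobject.mk_eq_bot_iff_zero.2
      ((isZero_columnFiltration D (n + 1) n (by lia)).eq_of_src _ _)
  · subst hpq
    exact ⟨@cokernelOfLEIso _ _ _ _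
      ((columnSpectralObject D).shortComplexOpcyclesThreeδ₂Toδ₁_shortExact _ _ _ _ _ _ _ _ _ _)
      _ (a (p + 1)) (a p) (ha (p + 1)) (ha p) (hS p) _ ≪≫ columnGradedIso D p q r hr hp hq⟩

end Convergence

/-! ### The normalized subcomplex computes the cohomology of the unnormalized complex -/

section Normalization

open AlgebraicTopology AlgebraicTopology.DoldKan

lemma alternatingCofaceMapComplex_d {B : Type*} [Category B] [Preadditive B]
    (X : CosimplicialObject B) (n : ℕ) :
    ((alternatingCofaceMapComplex B).obj X).d n (n + 1) = AlternatingCofaceMapComplex.objD X n :=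
  CochainComplex.of_d (fun n => X.obj (.mk n)) _ n

lemma objD_zero {B : Type*} [Category B] [Preadditive B] (X : CosimplicialObject B) :
    AlternatingCofaceMapComplex.objD X 0 = X.δ 0 - X.δ 1 := by
  rw [AlternatingCofaceMapComplex.objD, Fin.sum_univ_two]
  simp [sub_eq_add_neg]

variable {A : Type u} [Category.{v} A] [Abelian A] (X : CosimplicialObject A)

/-- The simplicial object in `Aᵒᵖ` which corresponds to a cosimplicial object in `A`. -/
abbrev opSimplicial : SimplicialObject Aᵒᵖ :=
  (cosimplicialSimplicialEquiv A).functor.obj (Opposite.op X)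

/-- The Dold-Kan projection on the unnormalized complex of a cosimplicial object. -/
def normProj (n : ℕ) : X.obj (.mk n) ⟶ X.obj (.mk n) :=
  ((PInfty : AlternatingFaceMapComplex.obj (opSimplicial X) ⟶ _).f n).unop

/-- The homotopy between the Dold-Kan projection and the identity. -/
def normHomotopy (i j : ℕ) : X.obj (.mk i) ⟶ X.obj (.mk j) :=
  ((homotopyPInftyToId (opSimplicial X)).hom j i).unop

lemma normProj_zero : normProj X 0 = 𝟙 _ := rfl

lemma normProj_σ (n : ℕ) (i : Fin (n + 1)) : normProj X (n + 1) ≫ X.σ i = 0 :=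
  congrArg Quiver.Hom.unop (σ_comp_PInfty (opSimplicial X) i)

/-- The Dold-Kan projection is the identity on the normalized subcomplex: by `decomposition_Q`,
its complement is a sum of maps that factor through the codegeneracies. -/
lemma arrow_normProj (n : ℕ) : (normX X n).arrow ≫ normProj X n = (normX X n).arrow := by
  cases n with
  | zero => rw [normProj_zero, Category.comp_id]
  | succ n =>
    have e := PInfty_f_add_QInfty_f (X := opSimplicial X) (n + 1)
    rw [QInfty_f, decomposition_Q] at e
    have e' : normProj X (n + 1) + ∑ i : Fin (n + 1) with i.val < n + 1,
        X.σ i.rev ≫ X.δ i.rev.succ ≫ (show X.obj (.mk (n + 1)) ⟶ X.obj (.mk (n + 1)) from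
          ((P (X := opSimplicial X) i).f (n + 1)).unop) = 𝟙 _ := by
      refine Eq.trans ?_ (congrArg Quiver.Hom.unop e)
      refine Eq.trans ?_ (unop_add _ _ _).symm
      refine congrArg (normProj X (n + 1) + ·) (Eq.trans ?_ (unop_sum _ _ _ _).symm)
      exact Finset.sum_congr rfl fun i _ => (Category.assoc _ _ _).symm
    have e'' := congrArg ((normX X (n + 1)).arrow ≫ ·) e'
    dsimp only at e''
    rw [Preadditive.comp_add, Preadditive.comp_sum, Finset.sum_eq_zero (fun i _ => by
      rw [← Category.assoc, normX_arrow_σ, zero_comp]), add_zero,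
      Category.comp_id] at e''
    exact e''

lemma normProj_objD (n : ℕ) : normProj X n ≫ AlternatingCofaceMapComplex.objD X n =
    AlternatingCofaceMapComplex.objD X n ≫ normProj X (n + 1) := by
  have e := (PInfty : AlternatingFaceMapComplex.obj (opSimplicial X) ⟶ _).comm (n + 1) n
  rw [AlternatingFaceMapComplex.obj_d_eq] at e
  rw [AlternatingCofaceMapComplex.d_eq_unop_d]
  exact (congrArg Quiver.Hom.unop e).symm

lemma normProj_succ (n : ℕ) : normProj X (n + 1) =
    normHomotopy X (n + 1) n ≫ AlternatingCofaceMapComplex.objD X n +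
      AlternatingCofaceMapComplex.objD X (n + 1) ≫ normHomotopy X (n + 2) (n + 1) + 𝟙 _ := by
  have e := (homotopyPInftyToId (opSimplicial X)).comm (n + 1)
  rw [Homotopy.dNext_succ_chainComplex, Homotopy.prevD_chainComplex,
    AlternatingFaceMapComplex.obj_d_eq, AlternatingFaceMapComplex.obj_d_eq] at e
  rw [AlternatingCofaceMapComplex.d_eq_unop_d, AlternatingCofaceMapComplex.d_eq_unop_d]
  exact congrArg Quiver.Hom.unop e

lemma normProj_factors (n : ℕ) : (normX X n).Factors (normProj X n) := by
  cases n with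
  | zero => exact Subobject.top_factors _
  | succ n => exact normX_factors_succ X n _ (normProj_σ X n)

lemma normalizedCochainComplex_d (n : ℕ) :
    ((normalizedCochainComplex A).obj X).d n (n + 1) = normD X n :=
  CochainComplex.of_d _ (normD X) n

/-- The component in degree `n` of the retraction of the unnormalized complex onto
the normalized subcomplex. -/
def normRetractionX (n : ℕ) : X.obj (.mk n) ⟶ (normX X n : A) :=
  Subobject.factorThru _ _ (normProj_factors X n)

lemma normRetractionX_arrow (n : ℕ) : normRetractionX X n ≫ (normX X n).arrow = normProj X n :=
  Subobject.factorThru_arrow _ _ _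

lemma arrow_normRetractionX (n : ℕ) : (normX X n).arrow ≫ normRetractionX X n = 𝟙 _ := by
  rw [← cancel_mono (normX X n).arrow, Category.assoc, normRetractionX_arrow, arrow_normProj,
    Category.id_comp]

lemma normRetractionX_normD (n : ℕ) : normRetractionX X n ≫ normD X n =
    AlternatingCofaceMapComplex.objD X n ≫ normRetractionX X (n + 1) := by
  rw [← cancel_mono (normX X (n + 1)).arrow, Category.assoc, Category.assoc, normD_arrow,
    normRetractionX_arrow, ← Category.assoc, normRetractionX_arrow, normProj_objD]

/-- The retraction of the unnormalized complex onto the normalized subcomplex. -/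
def normRetraction : (alternatingCofaceMapComplex A).obj X ⟶ (normalizedCochainComplex A).obj X :=
  CochainComplex.ofHom (normRetractionX X) fun n =>
    (congrArg (normRetractionX X n ≫ ·) (normalizedCochainComplex_d X n)).trans
      ((normRetractionX_normD X n).trans
        (congrArg (· ≫ normRetractionX X (n + 1)) (alternatingCofaceMapComplex_d X n).symm))

/-- The inclusion of the normalized subcomplex is a homotopy equivalence. -/
def normalizedInclusionHomotopyEquiv :
    HomotopyEquiv ((normalizedCochainComplex A).obj X) ((alternatingCofaceMapComplex A).obj X) where
  hom := (normalizedInclusion A).app X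
  inv := normRetraction X
  homotopyHomInvId := Homotopy.ofEq (by
    ext n
    exact arrow_normRetractionX X n)
  homotopyInvHomId :=
    { hom := normHomotopy X
      zero i j h := congrArg Quiver.Hom.unop ((homotopyPInftyToId (opSimplicial X)).zero j i h)
      comm n := by
        refine (normRetractionX_arrow X n).trans ?_
        cases n with
        | zero =>
          refine Eq.trans ?_ (congrArg (· + 𝟙 (X.obj (.mk 0))) ((congrArg₂ (· + ·)
            (Homotopy.dNext_cochainComplex _ 0) (Homotopy.prevD_zero_cochainComplex _)).trans
              (add_zero _))).symm
          have e := (homotopyPInftyToId (opSimplicial X)).comm 0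
          rw [Homotopy.dNext_zero_chainComplex, Homotopy.prevD_chainComplex,
            AlternatingFaceMapComplex.obj_d_eq, zero_add] at e
          refine (congrArg Quiver.Hom.unop e).trans ?_
          refine congrArg (· + 𝟙 (X.obj (.mk 0))) ?_
          refine Eq.trans ?_
            (congrArg (· ≫ normHomotopy X 1 0) (alternatingCofaceMapComplex_d X 0)).symm
          rw [AlternatingCofaceMapComplex.d_eq_unop_d]
          rfl
        | succ n =>
          refine Eq.trans ?_ (congrArg (· + 𝟙 (X.obj (.mk (n + 1)))) (congrArg₂ (· + ·)
            (Homotopy.dNext_cochainComplex _ (n + 1))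
            (Homotopy.prevD_succ_cochainComplex _ n))).symm
          refine (normProj_succ X n).trans ?_
          refine congrArg (· + 𝟙 (X.obj (.mk (n + 1)))) ?_
          refine (add_comm _ _).trans ?_
          exact (congrArg₂ (fun (a b : X.obj (.mk (n + 1)) ⟶ X.obj (.mk (n + 1))) => a + b)
            (congrArg (· ≫ normHomotopy X (n + 2) (n + 1))
              (alternatingCofaceMapComplex_d X (n + 1)))
            (congrArg (normHomotopy X (n + 1) n ≫ ·) (alternatingCofaceMapComplex_d X n))).symm }

instance : QuasiIso ((normalizedInclusion A).app X) :=
  (normalizedInclusionHomotopyEquiv X).quasiIso_hom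

/-- Cohomotopy is the cohomology of the unnormalized complex, through the inclusion of the
normalized one. -/
def cohomotopyIso (n : ℕ) : cohomotopy A n ≅
    alternatingCofaceMapComplex A ⋙ HomologicalComplex.homologyFunctor A (ComplexShape.up ℕ) n :=
  NatIso.ofComponents
    (fun X => (normalizedInclusionHomotopyEquiv X).toHomologyIso n)
    (fun {X Y} f => by
      refine (HomologicalComplex.homologyMap_comp _ _ n).symm.trans (Eq.trans ?_
        (HomologicalComplex.homologyMap_comp _ _ n))
      exact congrArg (HomologicalComplex.homologyMap · n) ((normalizedInclusion A).naturality f))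

end Normalization

/-! ### Décalage of cosimplicial objects -/

section Shift

open AlgebraicTopology

/-- The functor `[n] ↦ [n + 1]` that adds a smallest element to finite ordinals. -/
def simplexShift : SimplexCategory ⥤ SimplexCategory where
  obj a := .mk (a.len + 1)
  map {a b} f := SimplexCategory.Hom.mk
    ⟨Fin.cases 0 fun i => (f.toOrderHom i).succ, fun i j => by
      refine Fin.cases (fun _ => Fin.zero_le _) (fun i => ?_) i
      refine Fin.cases (fun h => absurd h (by simp)) (fun j h => ?_) j
      exact Fin.succ_le_succ_iff.2 (f.toOrderHom.monotone (Fin.succ_le_succ_iff.1 h))⟩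
  map_id a := by
    ext i : 3
    refine Fin.cases rfl (fun i => rfl) i
  map_comp f g := by
    ext i : 3
    refine Fin.cases rfl (fun i => rfl) i

lemma simplexShift_map_δ {n : ℕ} (i : Fin (n + 2)) :
    simplexShift.map (SimplexCategory.δ i) = SimplexCategory.δ i.succ := by
  ext j : 3
  refine Fin.cases ?_ (fun j => ?_) j
  · exact (Fin.succ_succAbove_zero i).symm
  · exact (Fin.succ_succAbove_succ i j).symm

/-- The natural inclusion `[n] ⟶ [n + 1]` that omits the smallest element. -/
def simplexShiftδ : 𝟭 SimplexCategory ⟶ simplexShift where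
  app a := SimplexCategory.δ (n := a.len) 0
  naturality a b f := by
    ext i : 3
    rfl

/-- A retraction of `simplexShiftδ`. It is not natural. -/
def simplexShiftσ (a : SimplexCategory) : simplexShift.obj a ⟶ a :=
  SimplexCategory.σ (n := a.len) 0

lemma simplexShiftδ_simplexShiftσ (a : SimplexCategory) :
    simplexShiftδ.app a ≫ simplexShiftσ a = 𝟙 a :=
  SimplexCategory.δ_comp_σ_self (n := a.len) (i := 0)

variable {A : Type u} [Category.{v} A]

/-- The décalage `X^{* + 1}` of a cosimplicial object `X`. -/
abbrev shift (X : CosimplicialObject A) : CosimplicialObject A := simplexShift ⋙ X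

lemma shift_δ (X : CosimplicialObject A) {n : ℕ} (i : Fin (n + 2)) :
    CosimplicialObject.δ (shift X) i = X.δ i.succ :=
  congrArg X.map (simplexShift_map_δ i)

variable [Preadditive A] (X : CosimplicialObject A)

/-- The differential of the unnormalized complex of a décalage: the cofaces of `X` other than the
first one appear in it. -/
def shiftD (n : ℕ) : X.obj (.mk (n + 1)) ⟶ X.obj (.mk (n + 2)) :=
  ∑ i : Fin (n + 2), (-1 : ℤ) ^ (i : ℕ) • X.δ i.succ

lemma objD_shift (n : ℕ) : AlternatingCofaceMapComplex.objD (shift X) n = shiftD X n :=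
  Finset.sum_congr rfl fun i _ => congrArg ((-1 : ℤ) ^ (i : ℕ) • ·) (shift_δ X i)

/-- The codegeneracy `σ^0` is a contracting homotopy of the unnormalized complex of a décalage, in
positive degrees. -/
lemma shiftD_σ (n : ℕ) :
    shiftD X (n + 1) ≫ X.σ (n := n + 2) 0 + X.σ (n := n + 1) 0 ≫ shiftD X n =
        𝟙 (X.obj (.mk (n + 2))) := by
  have e₁ : X.δ (n := n + 2) (Fin.succ 0) ≫ X.σ 0 = 𝟙 _ := X.δ_comp_σ_succ
  have e₂ (i : Fin (n + 2)) : X.δ (n := n + 2) i.succ.succ ≫ X.σ 0 =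
      X.σ (n := n + 1) 0 ≫ X.δ i.succ :=
    X.δ_comp_σ_of_gt (j := 0) (i := i.succ) (Fin.succ_pos i)
  rw [shiftD, shiftD, Fin.sum_univ_succ, Preadditive.add_comp, Preadditive.sum_comp,
    Preadditive.comp_sum]
  simp only [Preadditive.zsmul_comp, Preadditive.comp_zsmul, e₁, e₂, Fin.val_succ, pow_succ]
  simp

end Shift

section ShiftHomology

open AlgebraicTopology HomologicalComplex

variable {A : Type u} [Category.{v} A] [Abelian A] (X : CosimplicialObject A)

/-- The unnormalized complex of a décalage has no cohomology in positive degrees. -/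
lemma isZero_homology_shift (n : ℕ) :
    IsZero (((alternatingCofaceMapComplex A).obj (shift X)).homology (n + 1)) := by
  rw [← exactAt_iff_isZero_homology,
    exactAt_iff' _ n (n + 1) (n + 2) (CochainComplex.prev_nat_succ n)
      (CochainComplex.next ℕ (n + 1)),
    ShortComplex.exact_iff_exact_up_to_refinements]
  intro Z x hx
  have e₁ : ((alternatingCofaceMapComplex A).obj (shift X)).d n (n + 1) = shiftD X n :=
    (alternatingCofaceMapComplex_d (shift X) n).trans (objD_shift X n)
  have e₂ : ((alternatingCofaceMapComplex A).obj (shift X)).d (n + 1) (n + 2) = shiftD X (n + 1) :=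
    (alternatingCofaceMapComplex_d (shift X) (n + 1)).trans (objD_shift X (n + 1))
  have key : ∀ x : Z ⟶ X.obj (.mk (n + 2)), x ≫ shiftD X (n + 1) = 0 →
      𝟙 Z ≫ x = (x ≫ X.σ (n := n + 1) 0) ≫ shiftD X n := fun x hx => by
    have e₃ : x ≫ (shiftD X (n + 1) ≫ X.σ (n := n + 2) 0 +
        X.σ (n := n + 1) 0 ≫ shiftD X n) = x ≫ 𝟙 (X.obj (.mk (n + 2))) :=
      congrArg (x ≫ ·) (shiftD_σ X n)
    rw [Preadditive.comp_add, ← Category.assoc, hx, zero_comp, zero_add, Category.comp_id] at e₃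
    rw [Category.id_comp, Category.assoc, e₃]
  exact ⟨Z, 𝟙 Z, inferInstance, x ≫ X.σ (n := n + 1) 0,
    (key x ((congrArg (x ≫ ·) e₂).symm.trans hx)).trans
      (congrArg ((x ≫ X.σ (n := n + 1) 0) ≫ ·) e₁).symm⟩

end ShiftHomology

/-! ### Comparison of effaceable cohomological functors -/

section Comparison

open HomologicalComplex

variable {C : Type*} [Category C] [Preadditive C] {A : Type u} [Category.{v} A] [Abelian A]
  (S : C ⥤ ShortComplex C) (F G : C ⥤ CochainComplex A ℕ)
  [F.PreservesZeroMorphisms] [G.PreservesZeroMorphisms]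

/-- If `0 ⟶ X ⟶ Y ⟶ Q ⟶ 0` is a short exact sequence of cochain complexes and `H^{n+1}(Y) = 0`,
then `H^{n+1}(X)` is the cokernel of `H^n(Y) ⟶ H^n(Q)`. -/
def cokernelHomologyIso {T : ShortComplex (CochainComplex A ℕ)} (hT : T.ShortExact) (n : ℕ)
    (h : IsZero (T.X₂.homology (n + 1))) :
    cokernel (homologyMap T.g n) ≅ T.X₁.homology (n + 1) :=
  have : Epi (ShortComplex.mk _ _ (hT.comp_δ n (n + 1) rfl)).g :=
    (hT.homology_exact₁ n (n + 1) rfl).epi_f (h.eq_of_tgt _ _)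
  IsColimit.coconePointUniqueUpToIso (colimit.isColimit _)
    (hT.homology_exact₃ n (n + 1) rfl).gIsCokernel

lemma π_cokernelHomologyIso_hom {T : ShortComplex (CochainComplex A ℕ)} (hT : T.ShortExact) (n : ℕ)
    (h : IsZero (T.X₂.homology (n + 1))) :
    cokernel.π (homologyMap T.g n) ≫ (cokernelHomologyIso hT n h).hom = hT.δ n (n + 1) rfl :=
  have : Epi (ShortComplex.mk _ _ (hT.comp_δ n (n + 1) rfl)).g :=
    (hT.homology_exact₁ n (n + 1) rfl).epi_f (h.eq_of_tgt _ _)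
  IsColimit.comp_coconePointUniqueUpToIso_hom (colimit.isColimit _)
    (hT.homology_exact₃ n (n + 1) rfl).gIsCokernel WalkingParallelPair.one

variable {S F G}

/-- A natural isomorphism `H^n ∘ F ≅ H^n ∘ G` induces an isomorphism in degree `n + 1` for the
first object of an exact sequence whose middle object is killed by both functors. -/
def homologyIsoSucc {n : ℕ}
    (e : F ⋙ homologyFunctor A (ComplexShape.up ℕ) n ≅
      G ⋙ homologyFunctor A (ComplexShape.up ℕ) n)
    {T : ShortComplex C} (hF : (T.map F).ShortExact) (hG : (T.map G).ShortExact)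
    (hF₀ : IsZero ((F.obj T.X₂).homology (n + 1))) (hG₀ : IsZero ((G.obj T.X₂).homology (n + 1))) :
    (F.obj T.X₁).homology (n + 1) ≅ (G.obj T.X₁).homology (n + 1) :=
  (cokernelHomologyIso hF n hF₀).symm ≪≫
    cokernel.mapIso _ _ (e.app T.X₂) (e.app T.X₃) (e.hom.naturality T.g) ≪≫
      cokernelHomologyIso hG n hG₀

lemma δ_homologyIsoSucc_hom {n : ℕ}
    (e : F ⋙ homologyFunctor A (ComplexShape.up ℕ) n ≅
      G ⋙ homologyFunctor A (ComplexShape.up ℕ) n)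
    {T : ShortComplex C} (hF : (T.map F).ShortExact) (hG : (T.map G).ShortExact)
    (hF₀ : IsZero ((F.obj T.X₂).homology (n + 1))) (hG₀ : IsZero ((G.obj T.X₂).homology (n + 1))) :
    hF.δ n (n + 1) rfl ≫ (homologyIsoSucc e hF hG hF₀ hG₀).hom =
      e.hom.app T.X₃ ≫ hG.δ n (n + 1) rfl := by
  rw [← π_cokernelHomologyIso_hom hF n hF₀, ← π_cokernelHomologyIso_hom hG n hG₀]
  refine (Category.assoc _ _ _).trans ?_
  refine (congrArg (cokernel.π (homologyMap (F.map T.g) n) ≫ ·)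
    (Iso.hom_inv_id_assoc (cokernelHomologyIso hF n hF₀) _)).trans ?_
  exact (cokernel.π_desc_assoc (homologyMap (F.map T.g) n)
    (e.hom.app T.X₃ ≫ cokernel.π (homologyMap (G.map T.g) n)) _ _).trans (Category.assoc _ _ _)

/-- Two functors to cochain complexes that turn short exact sequences `0 ⟶ X ⟶ P X ⟶ Q X ⟶ 0`
depending functorially on `X` into short exact sequences have isomorphic cohomology as soon as they
do in degree zero and both kill the objects `P X` in positive degrees. -/
lemma nonempty_homologyFunctor_iso (hS : S ⋙ ShortComplex.π₁ = 𝟭 C)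
    (hF : ∀ X, ((S.obj X).map F).ShortExact) (hG : ∀ X, ((S.obj X).map G).ShortExact)
    (hF₀ : ∀ X n, IsZero ((F.obj (S.obj X).X₂).homology (n + 1)))
    (hG₀ : ∀ X n, IsZero ((G.obj (S.obj X).X₂).homology (n + 1)))
    (e₀ : F ⋙ homologyFunctor A (ComplexShape.up ℕ) 0 ≅
      G ⋙ homologyFunctor A (ComplexShape.up ℕ) 0) (n : ℕ) :
    Nonempty (F ⋙ homologyFunctor A (ComplexShape.up ℕ) n ≅
      G ⋙ homologyFunctor A (ComplexShape.up ℕ) n) := by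
  induction n with
  | zero => exact ⟨e₀⟩
  | succ n hn =>
    obtain ⟨e⟩ := hn
    have e' : (S ⋙ ShortComplex.π₁) ⋙ F ⋙ homologyFunctor A (ComplexShape.up ℕ) (n + 1) ≅
        (S ⋙ ShortComplex.π₁) ⋙ G ⋙ homologyFunctor A (ComplexShape.up ℕ) (n + 1) :=
      NatIso.ofComponents (fun X => homologyIsoSucc e (hF X) (hG X) (hF₀ X n) (hG₀ X n))
        (fun {X Y} f => by
          have : Epi ((hF X).δ n (n + 1) rfl) :=
            ((hF X).homology_exact₁ n (n + 1) rfl).epi_f ((hF₀ X n).eq_of_tgt _ _)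
          have h₁ := HomologySequence.δ_naturality (F.mapShortComplex.map (S.map f))
            (hF X) (hF Y) n (n + 1) rfl
          have h₂ := HomologySequence.δ_naturality (G.mapShortComplex.map (S.map f))
            (hG X) (hG Y) n (n + 1) rfl
          have h₃ := δ_homologyIsoSucc_hom e (hF X) (hG X) (hF₀ X n) (hG₀ X n)
          have h₄ := δ_homologyIsoSucc_hom e (hF Y) (hG Y) (hF₀ Y n) (hG₀ Y n)
          have h₅ := e.hom.naturality (S.map f).τ₃
          -- naturality is checked after composition with the connecting morphism, where it is
          -- the naturality of `e`
          refine (cancel_epi ((hF X).δ n (n + 1) rfl)).1 ?_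
          refine (Category.assoc _ _ _).symm.trans ?_
          refine (congrArg (· ≫ (homologyIsoSucc e (hF Y) (hG Y) (hF₀ Y n) (hG₀ Y n)).hom)
            h₁).trans ?_
          refine (Category.assoc _ _ _).trans ?_
          refine (congrArg (_ ≫ ·) h₄).trans ?_
          refine (Category.assoc _ _ _).symm.trans ?_
          refine (congrArg (· ≫ (hG Y).δ n (n + 1) rfl) h₅).trans ?_
          refine (Category.assoc _ _ _).trans ?_
          refine (congrArg (_ ≫ ·) h₂.symm).trans ?_
          refine (Category.assoc _ _ _).symm.trans ?_
          refine (congrArg (· ≫ _) h₃.symm).trans ?_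
          exact Category.assoc _ _ _)
    rw [hS] at e'
    exact ⟨e'⟩

end Comparison

/-! ### Cohomology in degree zero -/

section DegreeZero

open AlgebraicTopology HomologicalComplex

variable {A : Type u} [Category.{v} A] [Abelian A]

section

variable (D : HomologicalComplex₂ A (ComplexShape.up ℕ) (ComplexShape.up ℕ))

lemma ιTotal_zero_d_eq_zero_iff {Z : A} (f : Z ⟶ (D.X 0).X 0) :
    f ≫ D.ιTotal (ComplexShape.up ℕ) 0 0 0 rfl ≫ (D.total (ComplexShape.up ℕ)).d 0 1 = 0 ↔
      f ≫ (D.d 0 1).f 0 = 0 ∧ f ≫ (D.X 0).d 0 1 = 0 := by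
  have e := ιTotal_d D 0 0 0 1 rfl rfl
  rw [pow_zero, one_smul] at e
  rw [e, Preadditive.comp_add]
  constructor
  · intro h
    have h₁ := congrArg (· ≫ πTotal D 1 0 1 rfl) h
    have h₂ := congrArg (· ≫ πTotal D 0 1 1 rfl) h
    simp only [Preadditive.add_comp, Category.assoc, zero_comp] at h₁ h₂
    rw [ιTotal_πTotal, ιTotal_πTotal_of_ne _ _ _ _ _ _ _ _ (by lia), comp_zero, comp_zero, add_zero,
      Category.comp_id] at h₁
    rw [ιTotal_πTotal, ιTotal_πTotal_of_ne _ _ _ _ _ _ _ _ (by lia), comp_zero, comp_zero, zero_add,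
      Category.comp_id] at h₂
    exact ⟨h₁, h₂⟩
  · rintro ⟨h₁, h₂⟩
    rw [← Category.assoc, h₁, ← Category.assoc, h₂, zero_comp, zero_comp, add_zero]

lemma πTotal_ιTotal_zero :
    πTotal D 0 0 0 rfl ≫ D.ιTotal (ComplexShape.up ℕ) 0 0 0 rfl = 𝟙 _ :=
  πTotal_ιTotal D 0 0 0 rfl fun p' q' h h' => absurd h (by lia)

end

section

variable {K L K' L' : CochainComplex A ℕ} (e : K.X 0 ≅ L.X 0) (e' : K'.X 0 ≅ L'.X 0)

/-- An isomorphism in degree `0` that identifies the kernels of the differentials induces an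
isomorphism on cohomology in degree `0`. -/
def homologyZeroIso
    (h : ∀ {Z : A} (f : Z ⟶ L.X 0), f ≫ L.d 0 1 = 0 ↔ (f ≫ e.inv) ≫ K.d 0 1 = 0) :
    K.homology 0 ≅ L.homology 0 :=
  K.isoHomologyπ₀.symm ≪≫
    { hom := liftCycles _ (iCycles _ 0 ≫ e.hom) 1 (CochainComplex.next ℕ 0) (by
        rw [h, Category.assoc (iCycles K 0), e.hom_inv_id, Category.comp_id, iCycles_d])
      inv := liftCycles _ (iCycles _ 0 ≫ e.inv) 1 (CochainComplex.next ℕ 0)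
        ((h _).1 (iCycles_d _ 0 1))
      hom_inv_id := by
        rw [← cancel_mono (iCycles _ 0), Category.assoc, liftCycles_i, liftCycles_i_assoc,
          Category.assoc, Iso.hom_inv_id, Category.comp_id, Category.id_comp]
      inv_hom_id := by
        rw [← cancel_mono (iCycles _ 0), Category.assoc, liftCycles_i, liftCycles_i_assoc,
          Category.assoc, Iso.inv_hom_id, Category.comp_id, Category.id_comp] } ≪≫
    L.isoHomologyπ₀

lemma homologyZeroIso_naturality
    (h : ∀ {Z : A} (f : Z ⟶ L.X 0), f ≫ L.d 0 1 = 0 ↔ (f ≫ e.inv) ≫ K.d 0 1 = 0)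
    (h' : ∀ {Z : A} (f : Z ⟶ L'.X 0), f ≫ L'.d 0 1 = 0 ↔ (f ≫ e'.inv) ≫ K'.d 0 1 = 0)
    (φ : K ⟶ K') (ψ : L ⟶ L') (w : e.inv ≫ φ.f 0 = ψ.f 0 ≫ e'.inv) :
    homologyMap φ 0 ≫ (homologyZeroIso e' h').hom =
      (homologyZeroIso e h).hom ≫ homologyMap ψ 0 := by
  have w' : φ.f 0 ≫ e'.hom = e.hom ≫ ψ.f 0 := by
    rw [← Iso.eq_comp_inv, Category.assoc, ← w, e.hom_inv_id_assoc]
  rw [← cancel_mono L'.isoHomologyπ₀.inv]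
  simp only [homologyZeroIso, Iso.trans_hom, Iso.symm_hom, Category.assoc, Iso.hom_inv_id,
    Category.comp_id, CochainComplex.isoHomologyπ₀_inv_naturality,
    CochainComplex.isoHomologyπ₀_inv_naturality_assoc, Iso.hom_inv_id_assoc]
  rw [← cancel_mono (iCycles _ 0)]
  simp only [Category.assoc, liftCycles_i, cyclesMap_i, cyclesMap_i_assoc, liftCycles_i_assoc, w']

end

variable (X : CosimplicialBicomplex A)

/-- The equalizer of the pairs of horizontal and of vertical cofaces `X^{0, 0} ⇉ X^{1, 0}` and
`X^{0, 0} ⇉ X^{0, 1}` is the equalizer of the diagonal pair `X^{0, 0} ⇉ X^{1, 1}`. -/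
lemma comp_objD_Diag_eq_zero_iff {Z : A} (f : Z ⟶ X.obj (.mk 0, .mk 0)) :
    f ≫ AlternatingCofaceMapComplex.objD ((Diag A).obj X) 0 = 0 ↔
      f ≫ (((doubleComplex A).obj X).d 0 1).f 0 = 0 ∧
        f ≫ (((doubleComplex A).obj X).X 0).d 0 1 = 0 := by
  let δ (i : Fin 2) : SimplexCategory.mk 0 ⟶ SimplexCategory.mk 1 := SimplexCategory.δ i
  let σ : SimplexCategory.mk 1 ⟶ SimplexCategory.mk 0 := SimplexCategory.σ 0
  have hδσ (i : Fin 2) : δ i ≫ σ = 𝟙 _ := Subsingleton.elim _ _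
  let d (i : Fin 2) := X.map (Prod.mkHom (δ i) (δ i))
  let h (i : Fin 2) := X.map (Prod.mkHom (δ i) (𝟙 (SimplexCategory.mk 0)))
  let v (i : Fin 2) := X.map (Prod.mkHom (𝟙 (SimplexCategory.mk 0)) (δ i))
  have e₁ : AlternatingCofaceMapComplex.objD ((Diag A).obj X) 0 = d 0 - d 1 := objD_zero _
  have e₂ : (((doubleComplex A).obj X).d 0 1).f 0 = h 0 - h 1 :=
    congr_hom ((alternatingCofaceMapComplex_d (((CosimplicialObject.whiskering _ _).obj
      (alternatingCofaceMapComplex A)).obj ((columns A).obj X)) 0).trans (objD_zero _)) 0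
  have e₃ : (((doubleComplex A).obj X).X 0).d 0 1 = v 0 - v 1 :=
    (alternatingCofaceMapComplex_d (((columns A).obj X).obj (.mk 0)) 0).trans (objD_zero _)
  have hd (i j : Fin 2) : v i ≫ X.map (Prod.mkHom (δ j) (𝟙 (SimplexCategory.mk 1))) =
      X.map (Prod.mkHom (δ j) (δ i)) :=
    (X.map_comp _ _).symm.trans (congrArg X.map
      (Prod.ext (Category.id_comp _) (Category.comp_id _)))
  have hd' (i j : Fin 2) : h i ≫ X.map (Prod.mkHom (𝟙 (SimplexCategory.mk 1)) (δ j)) =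
      X.map (Prod.mkHom (δ i) (δ j)) :=
    (X.map_comp _ _).symm.trans (congrArg X.map
      (Prod.ext (Category.comp_id _) (Category.id_comp _)))
  have hσ (i : Fin 2) : d i ≫ X.map (Prod.mkHom σ (𝟙 (SimplexCategory.mk 1))) = v i :=
    (X.map_comp _ _).symm.trans (congrArg X.map (Prod.ext (hδσ i) (Category.comp_id _)))
  have hσ' (i : Fin 2) : d i ≫ X.map (Prod.mkHom (𝟙 (SimplexCategory.mk 1)) σ) = h i :=
    (X.map_comp _ _).symm.trans (congrArg X.map (Prod.ext (Category.comp_id _) (hδσ i)))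
  have key : f ≫ d 0 = f ≫ d 1 ↔ f ≫ h 0 = f ≫ h 1 ∧ f ≫ v 0 = f ≫ v 1 := by
    constructor
    · -- the codegeneracies `X^{1, 1} ⟶ X^{1, 0}` and `X^{1, 1} ⟶ X^{0, 1}` recover the cofaces
      -- in each direction from the diagonal ones
      intro e
      exact ⟨by rw [← hσ', ← hσ', ← Category.assoc, e, Category.assoc],
        by rw [← hσ, ← hσ, ← Category.assoc, e, Category.assoc]⟩
    · -- the mixed map `X.map (δ 0, δ 1)` lies between the two diagonal ones
      rintro ⟨eh, ev⟩
      calc f ≫ d 0 = (f ≫ v 0) ≫ X.map (Prod.mkHom (δ 0) (𝟙 (SimplexCategory.mk 1))) :=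
            (congrArg (f ≫ ·) (hd 0 0).symm).trans (Category.assoc _ _ _).symm
        _ = f ≫ X.map (Prod.mkHom (δ 0) (δ 1)) := by rw [ev, Category.assoc, hd]
        _ = (f ≫ h 0) ≫ X.map (Prod.mkHom (𝟙 (SimplexCategory.mk 1)) (δ 1)) :=
            (congrArg (f ≫ ·) (hd' 0 1).symm).trans (Category.assoc _ _ _).symm
        _ = f ≫ d 1 := by rw [eh, Category.assoc, hd']
  have aux {W : A} (a b : X.obj (.mk 0, .mk 0) ⟶ W) : f ≫ (a - b) = 0 ↔ f ≫ a = f ≫ b := by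
    rw [Preadditive.comp_sub, sub_eq_zero]
  refine Iff.trans (iff_of_eq (congrArg (fun t => f ≫ t = 0) e₁)) ?_
  refine Iff.trans ((aux _ _).trans (key.trans (and_congr (aux _ _).symm (aux _ _).symm))) ?_
  exact and_congr (iff_of_eq (congrArg (fun t => f ≫ t = 0) e₂.symm))
    (iff_of_eq (congrArg (fun t => f ≫ t = 0) e₃.symm))

/-- `Tot X` and the unnormalized complex of `Diag X` both have `X^{0, 0}` in degree zero. -/
def totDiagX₀Iso : ((Tot A).obj X).X 0 ≅
    ((alternatingCofaceMapComplex A).obj ((Diag A).obj X)).X 0 where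
  hom := πTotal ((doubleComplex A).obj X) 0 0 0 rfl
  inv := ((doubleComplex A).obj X).ιTotal (ComplexShape.up ℕ) 0 0 0 rfl
  hom_inv_id := πTotal_ιTotal_zero _
  inv_hom_id := ιTotal_πTotal _ _ _ _ _

lemma comp_d_Diag_eq_zero_iff {Z : A}
    (f : Z ⟶ ((alternatingCofaceMapComplex A).obj ((Diag A).obj X)).X 0) :
    f ≫ ((alternatingCofaceMapComplex A).obj ((Diag A).obj X)).d 0 1 = 0 ↔
      (f ≫ (totDiagX₀Iso X).inv) ≫ ((Tot A).obj X).d 0 1 = 0 :=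
  (iff_of_eq (congrArg (fun t => f ≫ t = 0)
    (alternatingCofaceMapComplex_d ((Diag A).obj X) 0))).trans
      (((comp_objD_Diag_eq_zero_iff X f).trans
        (ιTotal_zero_d_eq_zero_iff ((doubleComplex A).obj X) f).symm).trans
          (iff_of_eq (congrArg (· = 0) (Category.assoc _ _ _).symm)))

variable (A) in
/-- The cohomology in degree zero of `Tot X` and of the unnormalized complex of `Diag X` agree. -/
def totDiagHomologyZeroIso : Tot A ⋙ homologyFunctor A (ComplexShape.up ℕ) 0 ≅
    (Diag A ⋙ alternatingCofaceMapComplex A) ⋙ homologyFunctor A (ComplexShape.up ℕ) 0 :=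
  NatIso.ofComponents
    (fun X => homologyZeroIso (totDiagX₀Iso X) (comp_d_Diag_eq_zero_iff X))
    (fun f => homologyZeroIso_naturality _ _ _ _ ((Tot A).map f)
      ((alternatingCofaceMapComplex A).map ((Diag A).map f))
      (HomologicalComplex₂.ιTotal_map _ _ ((doubleComplex A).map f) (ComplexShape.up ℕ) 0 0 0 rfl))

end DegreeZero

/-! ### The rows of the first page and the vanishing of the cohomology of a total complex -/

section Vanishing

open AlgebraicTopology HomologicalComplex

variable {A : Type u} [Category.{v} A] [Abelian A]

lemma map_objD {B : Type*} [Category B] [Preadditive B] (H : B ⥤ A) [H.Additive]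
    (W : CosimplicialObject B) (n : ℕ) :
    H.map (AlternatingCofaceMapComplex.objD W n) =
      AlternatingCofaceMapComplex.objD (((CosimplicialObject.whiskering _ _).obj H).obj W) n := by
  rw [AlternatingCofaceMapComplex.objD, H.map_sum]
  exact Finset.sum_congr rfl fun i _ => H.map_zsmul

/-- An additive functor commutes with the formation of unnormalized complexes. -/
def mapAlternatingCofaceMapComplexIso {B : Type*} [Category B] [Preadditive B] (H : B ⥤ A)
    [H.Additive] (W : CosimplicialObject B) :
    (H.mapHomologicalComplex (ComplexShape.up ℕ)).obj ((alternatingCofaceMapComplex B).obj W) ≅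
      (alternatingCofaceMapComplex A).obj (((CosimplicialObject.whiskering _ _).obj H).obj W) :=
  HomologicalComplex.Hom.isoOfComponents (fun n => Iso.refl (H.obj (W.obj (.mk n)))) (by
    rintro i _ rfl
    refine (Category.id_comp _).trans (Eq.trans ?_ (Category.comp_id _).symm)
    exact (alternatingCofaceMapComplex_d _ i).trans ((map_objD H W i).symm.trans
      (congrArg H.map (alternatingCofaceMapComplex_d W i).symm)))

/-- The cosimplicial object `p ↦ H^q(C(X^{p,*}))`. -/
abbrev verticalHomology (X : CosimplicialBicomplex A) (q : ℕ) : CosimplicialObject A :=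
  ((CosimplicialObject.whiskering _ _).obj (homologyFunctor A (ComplexShape.up ℕ) q)).obj
    (((CosimplicialObject.whiskering _ _).obj (alternatingCofaceMapComplex A)).obj
      ((columns A).obj X))

/-- The rows of the first page of the spectral sequence of the double complex of `X`. -/
def columnHomologyComplexIso (X : CosimplicialBicomplex A) (q : ℕ) :
    columnHomologyComplex ((doubleComplex A).obj X) q ≅
      (alternatingCofaceMapComplex A).obj (verticalHomology X q) :=
  mapAlternatingCofaceMapComplexIso _ _

/-- A zero object on some page of a spectral sequence is zero on all later pages. -/
lemma isZero_page_of_le {r₀ : ℤ} (E : CohomologicalSpectralSequenceNat A r₀) (r s : ℤ)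
    (hr : r₀ ≤ r) (hrs : r ≤ s) (pq : ℕ × ℕ) (h : IsZero ((E.page r hr).X pq)) :
    IsZero ((E.page s (hr.trans hrs)).X pq) := by
  induction s, hrs using Int.leInduction with
  | base => exact h
  | succ s hs hs' =>
    refine IsZero.of_iso ?_ (E.iso s (s + 1) pq rfl (hr.trans hs)).symm
    exact (ShortComplex.exact_iff_isZero_homology _).1 (ShortComplex.exact_of_isZero_X₂ _ hs')

/-- If some page vanishes in total degree `n`, so does the abutment in this degree. -/
lemma isZero_of_convergesTo {r₀ : ℤ} (E : CohomologicalSpectralSequenceNat A r₀) (H : ℕ → A)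
    (hE : ConvergesTo E H) (n : ℕ) (r : ℤ) (hr : r₀ ≤ r)
    (h : ∀ p q : ℕ, p + q = n → IsZero ((E.page r hr).X (p, q))) : IsZero (H n) := by
  obtain ⟨F, hF, hF₀, hFn, e⟩ := hE n
  have key (k : ℕ) (hk : k ≤ n + 1) : IsZero (F k : A) := by
    induction hk using Nat.decreasingInduction with
    | self => exact (isZero_zero A).of_iso (Subobject.isoOfEq _ _ hFn ≪≫ Subobject.botCoeIsoZero)
    | of_succ k hk h' =>
      obtain ⟨e⟩ := e k (n - k) (by lia) (max r (n + 2)) (hr.trans (le_max_left _ _)) (by lia)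
        (by lia)
      have := Preadditive.epi_of_isZero_cokernel (Subobject.ofLE _ _ (hF k.le_succ))
        ((isZero_page_of_le E r _ hr (le_max_left _ _) _ (h k (n - k) (by lia))).of_iso e)
      exact h'.of_epi (Subobject.ofLE _ _ (hF k.le_succ))
  have : IsIso (F 0).arrow := (Subobject.isIso_arrow_iff_eq_top _).2 hF₀
  exact (key 0 (by lia)).of_iso (asIso (F 0).arrow).symm

lemma isZero_homology_total (D : HomologicalComplex₂ A (ComplexShape.up ℕ) (ComplexShape.up ℕ))
    (n : ℕ) (h : ∀ p q, p + q = n → IsZero ((columnHomologyComplex D q).homology p)) :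
    IsZero ((D.total (ComplexShape.up ℕ)).homology n) :=
  isZero_of_convergesTo (columnSpectralSequence D)
    (fun n => (D.total (ComplexShape.up ℕ)).homology n)
    (convergesTo_columnSpectralSequence D _ fun _ => Iso.refl _) n 2 one_le_two
      fun p q hpq => (h p q hpq).of_iso (columnE₂Iso D p q)

/-- The cohomology of `Tot X` vanishes in positive degrees if that of the columns and that of
the cosimplicial objects `p ↦ H^q(C(X^{p,*}))` do. -/
lemma isZero_homology_Tot (X : CosimplicialBicomplex A) (n : ℕ)
    (h₁ : ∀ p q, IsZero (((alternatingCofaceMapComplex A).obj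
      (((columns A).obj X).obj (.mk p))).homology (q + 1)))
    (h₂ : ∀ p q, IsZero (((alternatingCofaceMapComplex A).obj (verticalHomology X q)).homology
      (p + 1))) :
    IsZero (((Tot A).obj X).homology (n + 1)) := by
  refine isZero_homology_total _ _ fun p q hpq => ?_
  refine IsZero.of_iso ?_ ((homologyFunctor A _ p).mapIso (columnHomologyComplexIso X q))
  cases p with
  | succ p => exact h₂ p q
  | zero =>
    obtain rfl : q = n + 1 := by lia
    exact (ShortComplex.exact_iff_isZero_homology _).1 (ShortComplex.exact_of_isZero_X₂ _ (h₁ 0 n))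

end Vanishing

/-! ### Décalage of cosimplicial bicomplexes -/

section BicomplexShift

open AlgebraicTopology HomologicalComplex

variable {A : Type u} [Category.{v} A]

variable (A) in
/-- The décalage `X^{* + 1, * + 1}` in both directions of a cosimplicial bicomplex. -/
abbrev bishift : CosimplicialBicomplex A ⥤ CosimplicialBicomplex A :=
  (Functor.whiskeringLeft _ _ A).obj (simplexShift.prod simplexShift)

variable (A) in
/-- The natural transformation from a cosimplicial bicomplex to its décalage, given by the
cofaces of index zero. -/
def bishiftι : 𝟭 (CosimplicialBicomplex A) ⟶ bishift A where
  app X :=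
    { app := fun k => X.map (Prod.mkHom (simplexShiftδ.app k.1) (simplexShiftδ.app k.2))
      naturality := fun k l f => (X.map_comp _ _).symm.trans
        ((congrArg X.map (Prod.ext (simplexShiftδ.naturality f.1)
          (simplexShiftδ.naturality f.2))).trans (X.map_comp _ _)) }
  naturality X Y f := by
    ext k
    exact (f.naturality _).symm

/-- An objectwise retraction of `bishiftι`. -/
def bishiftRetraction (X : CosimplicialBicomplex A) (k : SimplexCategory × SimplexCategory) :
    ((bishift A).obj X).obj k ⟶ X.obj k :=
  X.map (Prod.mkHom (simplexShiftσ k.1) (simplexShiftσ k.2))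

lemma bishiftι_bishiftRetraction (X : CosimplicialBicomplex A)
    (k : SimplexCategory × SimplexCategory) :
    ((bishiftι A).app X).app k ≫ bishiftRetraction X k = 𝟙 (X.obj k) :=
  (X.map_comp _ _).symm.trans ((congrArg X.map (Prod.ext (simplexShiftδ_simplexShiftσ k.1)
    (simplexShiftδ_simplexShiftσ k.2))).trans (X.map_id k))

variable [Abelian A]

variable (A) in
/-- The short complex `X ⟶ P X ⟶ Q X` where `P X` is the décalage of `X` in both directions and
`Q X` the cokernel of `X ⟶ P X`. -/
def bishiftShortComplex : CosimplicialBicomplex A ⥤ ShortComplex (CosimplicialBicomplex A) where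
  obj X := ShortComplex.mk ((bishiftι A).app X) (cokernel.π ((bishiftι A).app X))
    (cokernel.condition _)
  map {X Y} f :=
    { τ₁ := f
      τ₂ := (bishift A).map f
      τ₃ := cokernel.map _ _ f ((bishift A).map f) ((bishiftι A).naturality f).symm
      comm₁₂ := (bishiftι A).naturality f
      comm₂₃ := (cokernel.π_desc _ _ _).symm }
  map_id X := by
    ext1
    · rfl
    · exact (bishift A).map_id X
    · refine (cancel_epi (cokernel.π ((bishiftι A).app X))).1 ?_
      refine (cokernel.π_desc _ _ _).trans (Eq.trans ?_ (Category.comp_id _).symm)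
      exact (congrArg (· ≫ cokernel.π ((bishiftι A).app X)) ((bishift A).map_id X)).trans
        (Category.id_comp _)
  map_comp {X Y Z} f g := by
    ext1
    · rfl
    · exact (bishift A).map_comp f g
    · refine (cancel_epi (cokernel.π ((bishiftι A).app X))).1 ?_
      refine (cokernel.π_desc _ _ _).trans ?_
      refine (congrArg (· ≫ cokernel.π ((bishiftι A).app Z)) ((bishift A).map_comp f g)).trans ?_
      refine Eq.trans ?_ (cokernel.π_desc_assoc _ _ _ _).symm
      refine (Category.assoc _ _ _).trans (Eq.trans ?_ (Category.assoc _ _ _).symm)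
      exact congrArg ((bishift A).map f ≫ ·) (cokernel.π_desc _ _ _).symm

/-- The sequence `X ⟶ P X ⟶ Q X` is objectwise split exact. -/
def bishiftSplitting (X : CosimplicialBicomplex A) (k : SimplexCategory × SimplexCategory) :
    (((bishiftShortComplex A).obj X).map ((evaluation _ A).obj k)).Splitting :=
  have hS : ((bishiftShortComplex A).obj X).Exact := ShortComplex.exact_cokernel _
  have : Epi ((bishiftShortComplex A).obj X).g := by
    dsimp only [bishiftShortComplex]
    infer_instance
  have : Epi (((bishiftShortComplex A).obj X).map ((evaluation _ A).obj k)).g :=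
    inferInstanceAs (Epi (((evaluation _ A).obj k).map ((bishiftShortComplex A).obj X).g))
  ShortComplex.Splitting.ofExactOfRetraction _ (hS.map ((evaluation _ A).obj k))
    (bishiftRetraction X k) (bishiftι_bishiftRetraction X k) this

instance : (doubleComplex A).PreservesZeroMorphisms where
  map_zero X Y := by
    ext p q
    rfl

instance : (Tot A).PreservesZeroMorphisms :=
  inferInstanceAs (doubleComplex A ⋙ HomologicalComplex₂.totalFunctor A (ComplexShape.up ℕ)
    (ComplexShape.up ℕ) (ComplexShape.up ℕ)).PreservesZeroMorphisms

instance : (Diag A ⋙ alternatingCofaceMapComplex A).PreservesZeroMorphisms where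
  map_zero X Y := by
    ext p
    rfl

lemma shortExact_bishift_Tot (X : CosimplicialBicomplex A) :
    (((bishiftShortComplex A).obj X).map (Tot A)).ShortExact :=
  shortExact_total (((bishiftShortComplex A).obj X).map (doubleComplex A))
    (fun p q => (bishiftSplitting X (.mk p, .mk q)).r)
    (fun p q => (bishiftSplitting X (.mk p, .mk q)).s)
    (fun p q => (bishiftSplitting X (.mk p, .mk q)).f_r)
    (fun p q => (bishiftSplitting X (.mk p, .mk q)).s_g)
    (fun p q => (bishiftSplitting X (.mk p, .mk q)).id)

lemma shortExact_bishift_Diag (X : CosimplicialBicomplex A) :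
    (((bishiftShortComplex A).obj X).map (Diag A ⋙ alternatingCofaceMapComplex A)).ShortExact :=
  shortExact_of_degreewise_shortExact _ fun n => (bishiftSplitting X (.mk n, .mk n)).shortExact

lemma isZero_homology_Diag_bishift (X : CosimplicialBicomplex A) (n : ℕ) :
    IsZero (((alternatingCofaceMapComplex A).obj ((Diag A).obj ((bishift A).obj X))).homology
      (n + 1)) :=
  isZero_homology_shift ((Diag A).obj X) n

variable (A) in
/-- The décalage `X^{*, * + 1}` in the vertical direction of a cosimplicial bicomplex. -/
abbrev verticalShift : CosimplicialBicomplex A ⥤ CosimplicialBicomplex A :=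
  (Functor.whiskeringLeft _ _ A).obj ((𝟭 SimplexCategory).prod simplexShift)

/-- The décalage in both directions is the horizontal décalage of the vertical one. -/
def columnsBishiftIso (X : CosimplicialBicomplex A) :
    (columns A).obj ((bishift A).obj X) ≅ shift ((columns A).obj ((verticalShift A).obj X)) :=
  NatIso.ofComponents
    (fun p => NatIso.ofComponents
      (fun q => Iso.refl (X.obj (simplexShift.obj p, simplexShift.obj q)))
      (fun {q q'} f => by
        refine (Category.comp_id _).trans (Eq.trans ?_ (Category.id_comp _).symm)
        exact congrArg X.map (Prod.ext (simplexShift.map_id p) rfl)))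
    (fun {p p'} f => by
      ext q
      exact (Category.comp_id _).trans (Category.id_comp _).symm)

lemma isZero_homology_Tot_bishift (X : CosimplicialBicomplex A) (n : ℕ) :
    IsZero (((Tot A).obj ((bishift A).obj X)).homology (n + 1)) := by
  refine isZero_homology_Tot _ n (fun p q => ?_) (fun p q => ?_)
  · exact (isZero_homology_shift (((columns A).obj X).obj (.mk (p + 1))) q).of_iso
      ((alternatingCofaceMapComplex A ⋙ homologyFunctor A (ComplexShape.up ℕ) (q + 1)).mapIso
        ((columnsBishiftIso X).app (.mk p)))
  · exact (isZero_homology_shift (verticalHomology ((verticalShift A).obj X) q) p).of_iso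
      ((alternatingCofaceMapComplex A ⋙ homologyFunctor A (ComplexShape.up ℕ) (p + 1)).mapIso
        (((CosimplicialObject.whiskering _ _).obj (homologyFunctor A (ComplexShape.up ℕ) q)).mapIso
          (((CosimplicialObject.whiskering _ _).obj (alternatingCofaceMapComplex A)).mapIso
            (columnsBishiftIso X))))

variable (A) in
/-- The cohomology of `Tot X` is naturally isomorphic to that of the unnormalized complex of
`Diag X`. -/
lemma nonempty_totDiagHomologyIso (n : ℕ) :
    Nonempty (Tot A ⋙ homologyFunctor A (ComplexShape.up ℕ) n ≅
      (Diag A ⋙ alternatingCofaceMapComplex A) ⋙ homologyFunctor A (ComplexShape.up ℕ) n) :=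
  nonempty_homologyFunctor_iso (S := bishiftShortComplex A) rfl shortExact_bishift_Tot
    shortExact_bishift_Diag isZero_homology_Tot_bishift isZero_homology_Diag_bishift
    (totDiagHomologyZeroIso A) n

end BicomplexShift

/-! ### The cosimplicial Eilenberg-Zilber theorem -/

section EilenbergZilber

open AlgebraicTopology HomologicalComplex

variable {A : Type u} [Category.{v} A] [Abelian A]

variable (A) in
lemma nonempty_cohomotopy_Diag_iso (n : ℕ) : Nonempty (Diag A ⋙ cohomotopy A n ≅
    Tot A ⋙ homologyFunctor A (ComplexShape.up ℕ) n) := by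
  obtain ⟨e⟩ := nonempty_totDiagHomologyIso A n
  exact ⟨Functor.isoWhiskerLeft (Diag A) (cohomotopyIso n) ≪≫ e.symm⟩

variable (X : CosimplicialBicomplex A)

/-- The first page of the spectral sequence of the double complex of `X`. -/
def doubleComplexE₁Iso (p q : ℕ) :
    ((columnSpectralSequence ((doubleComplex A).obj X)).page 1 le_rfl).X (p, q) ≅
      (cohomotopy A q).obj (((columns A).obj X).obj (.mk p)) :=
  columnE₁Iso ((doubleComplex A).obj X) p q ≪≫
    ((cohomotopyIso q).app (((columns A).obj X).obj (.mk p))).symm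

lemma cohomotopyIso_inv_objD (p q : ℕ) :
    AlternatingCofaceMapComplex.objD (verticalHomology X q) p ≫
        (cohomotopyIso q).inv.app (((columns A).obj X).obj (.mk (p + 1))) =
      (cohomotopyIso q).inv.app (((columns A).obj X).obj (.mk p)) ≫
        ∑ i : Fin (p + 2), (-1 : ℤ) ^ (i : ℕ) •
            (cohomotopy A q).map (((columns A).obj X).δ i) := by
  refine (Preadditive.sum_comp _ _ _).trans (Eq.trans ?_ (Preadditive.comp_sum _ _ _).symm)
  refine Finset.sum_congr rfl fun i _ => ?_
  refine (Preadditive.zsmul_comp _ _ _).trans (Eq.trans ?_ (Preadditive.comp_zsmul _ _ _).symm)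
  exact congrArg ((-1 : ℤ) ^ (i : ℕ) • ·)
    ((cohomotopyIso q).inv.naturality (((columns A).obj X).δ i))

lemma homologyMap_doubleComplex_d (p q : ℕ) :
    homologyMap (((doubleComplex A).obj X).d p (p + 1)) q =
      AlternatingCofaceMapComplex.objD (verticalHomology X q) p := by
  have h := alternatingCofaceMapComplex_d (((CosimplicialObject.whiskering _ _).obj
    (alternatingCofaceMapComplex A)).obj ((columns A).obj X)) p
  exact (congrArg (homologyFunctor A (ComplexShape.up ℕ) q).map h).trans
    (map_objD (homologyFunctor A (ComplexShape.up ℕ) q) (((CosimplicialObject.whiskering _ _).obj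
      (alternatingCofaceMapComplex A)).obj ((columns A).obj X)) p)

lemma doubleComplexE₁Iso_comm (p q : ℕ) :
    ((columnSpectralSequence ((doubleComplex A).obj X)).page 1 le_rfl).d (p, q) (p + 1, q) ≫
        (doubleComplexE₁Iso X (p + 1) q).hom =
      (doubleComplexE₁Iso X p q).hom ≫ ∑ i : Fin (p + 2), (-1 : ℤ) ^ (i : ℕ) •
            (cohomotopy A q).map (((columns A).obj X).δ i) := by
  refine (Category.assoc _ _ _).symm.trans ?_
  refine (congrArg (· ≫ (cohomotopyIso q).inv.app (((columns A).obj X).obj (.mk (p + 1))))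
    (columnE₁Iso_comm ((doubleComplex A).obj X) p q)).trans ?_
  refine (Category.assoc _ _ _).trans (Eq.trans ?_ (Category.assoc _ _ _).symm)
  refine congrArg ((columnE₁Iso ((doubleComplex A).obj X) p q).hom ≫ ·) ?_
  exact (congrArg (· ≫ (cohomotopyIso q).inv.app (((columns A).obj X).obj (.mk (p + 1))))
    (homologyMap_doubleComplex_d X p q)).trans (cohomotopyIso_inv_objD X p q)

/-- The second page of the spectral sequence of the double complex of `X`. -/
def doubleComplexE₂Iso (p q : ℕ) :
    ((columnSpectralSequence ((doubleComplex A).obj X)).page 2 one_le_two).X (p, q) ≅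
      (cohomotopy A p).obj ((verticalCohomotopy A q).obj X) :=
  columnE₂Iso ((doubleComplex A).obj X) p q ≪≫
    (homologyFunctor A _ p).mapIso (columnHomologyComplexIso X q) ≪≫
      (cohomotopyIso p).symm.app (verticalHomology X q) ≪≫
        (cohomotopy A p).mapIso
          (Functor.isoWhiskerLeft ((columns A).obj X) (cohomotopyIso q).symm)

end EilenbergZilber

end CosimplicialEZ

end

open CosimplicialEZ in
theorem mainTheorem4 {A : Type u} [Category.{v} A] [Abelian A] [EnoughInjectives A] :
    -- `π^*(Diag X) = H^*(C(Diag X))`, through the inclusion `N(Diag X) ⟶ C(Diag X)`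
    (∀ X : CosimplicialBicomplex A,
      QuasiIso ((normalizedInclusion A).app ((Diag A).obj X))) ∧
    -- the natural isomorphism `π^n(Diag X) ≅ H^n(Tot X)`
    (∀ n : ℕ, Nonempty (Diag A ⋙ cohomotopy A n ≅
      Tot A ⋙ HomologicalComplex.homologyFunctor A (ComplexShape.up ℕ) n)) ∧
    -- the spectral sequence
    ∀ X : CosimplicialBicomplex A, ∃ E : CohomologicalSpectralSequenceNat A 1,
      -- `E_1^{p,q} = π_v^q(X^{p,*})`, where `d_1` is the alternating sum of the maps induced by
      -- the horizontal cofaces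
      (∃ e : ∀ p q : ℕ, (E.page 1 le_rfl).X (p, q) ≅
          (cohomotopy A q).obj (((columns A).obj X).obj (SimplexCategory.mk p)),
        ∀ p q : ℕ, (E.page 1 le_rfl).d (p, q) (p + 1, q) ≫ (e (p + 1) q).hom =
          (e p q).hom ≫ ∑ i : Fin (p + 2), (-1 : ℤ) ^ (i : ℕ) •
            (cohomotopy A q).map (((columns A).obj X).δ i)) ∧
      -- `E_2^{p,q} = π_h^p π_v^q(X)`
      (∀ p q : ℕ, Nonempty ((E.page 2 one_le_two).X (p, q) ≅
        (cohomotopy A p).obj ((verticalCohomotopy A q).obj X))) ∧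
      -- `E_r^{p,q} ⇒ π^{p+q}(Diag X)`
      ConvergesTo E (fun n => (cohomotopy A n).obj ((Diag A).obj X)) := by
  refine ⟨fun X => inferInstance, nonempty_cohomotopy_Diag_iso A, fun X =>
    ⟨columnSpectralSequence ((doubleComplex A).obj X),
      ⟨doubleComplexE₁Iso X, doubleComplexE₁Iso_comm X⟩,
      fun p q => ⟨doubleComplexE₂Iso X p q⟩,
      convergesTo_columnSpectralSequence _ _ fun n =>
        ((nonempty_cohomotopy_Diag_iso A n).some.app X).symm⟩⟩
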